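/- **Theorem.** Let $n\ge 1$ and $r,s\ge 0$ be integers with $$ r+s \;\le\; \frac{\binom{n+4}{5}}{\binom{n+1}{2}+n}-\left(\binom{n+1}{2}+n\right). $$ Then mixtures of $r$ Gaussians and $s$ symmetric multivariate Laplace distributions on $\mathbb R^n$, with known mixing weights, are algebraically identifiable from their degree-$5$ moments: for general parameters, these moments determine the parameters up to finitely many possibilities. Precisely, the following two statements hold. (1) *Complex moment forms.* For $\mu\in\mathbb C^n$ and a symmetric matrix $\Sigma\in\mathbb C^{n\times n}$ put $\ell_\mu=t^T\mu$ and $q_\Sigma=t^T\Sigma t$ in $\mathbb C[t_1,\dots,t_n]$, and $$ \mathcal M_5(\mathcal N(\mu,\Sigma))=\ell_\mu^5+10\,q_\Sigma\ell_\mu^3+15\,q_\Sigma^2\ell_\mu,\qquad \mathcal M_5(L(\mu,\Sigma))=\ell_\mu^5+10\,q_\Sigma\ell_\mu^3+30\,q_\Sigma^2\ell_\mu . $$ Fix weights $w_1,\dots,w_{r+s}\in\mathbb C\setminus\{0\}$. There is a polynomial $F$ in the entries of $(\mu_i,\Sigma_i)_{i=1}^{r+s}$, not identically zero on the space of families with all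 $\Sigma_i$ symmetric, such that for every such family with $F\ne 0$ there are only finitely many families $(\mu_i',\Sigma_i')_{i=1}^{r+s}$ in $\mathbb C^n\times\mathrm{Sym}_n(\mathbb C)$ with the same form $$ \sum_{i=1}^{r} w_i\,\mathcal M_5(\mathcal N(\mu_i,\Sigma_i))+\sum_{i=r+1}^{r+s} w_i\,\mathcal M_5(L(\mu_i,\Sigma_i)). $$ (2) *Probability distributions.* Let $L(\mu,\Sigma)$ denote the symmetric multivariate Laplace distribution, with characteristic function $e^{i\mu^Tt}/(1+\tfrac12 t^T\Sigma t)$. Fix real weights $w_1,\dots,w_{r+s}>0$ with $\sum_i w_i=1$. There is a real polynomial $F$ in the entries of $(\mu_i,\Sigma_i)_{i=1}^{r+s}$, not identically zero on the set of families with $\mu_i\in\mathbb R^n$ and $\Sigma_i\in\mathbb R^{n\times n}$ symmetric positive semidefinite, such that for every such family with $F\neq0$ there are only finitely many families $(\mu_i',\Sigma_i')_{i=1}^{r+s}$ of this kind for which the mixture $$ \sum_{i=1}^{r} w_i\,\mathcal N(\mu'_i,\Sigma'_i)+\sum_{i=r+1}^{r+s} w_i\,L(\mu'_i,\Sigma'_i)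 $$ has the same moments $\mathbb E[Y_{k_1}\cdots Y_{k_5}]$, $1\le k_1,\dots,k_5\le n$, as the mixture with parameters $(\mu_i,\Sigma_i)_{i=1}^{r+s}$. -/

import Mathlib

open MeasureTheory ProbabilityTheory

noncomputable section

namespace GaussLaplace

/-- Parameters, over a field `K`, of a family of location-scale distributions on `n`-space indexed
by `ι`: the means `θ.1 i` and the covariance (or scale) matrices `θ.2 i`. -/
abbrev Params (ι : Type) (n : ℕ) (K : Type) : Type :=
  (ι → Fin n → K) × (ι → Matrix (Fin n) (Fin n) K)

/-- The scalar coordinates of a parameter: the entries of all means and of all matrices. -/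
def Params.coords {ι : Type} {n : ℕ} {K : Type} (θ : Params ι n K) :
    ι × (Fin n ⊕ Fin n × Fin n) → K
  | (i, Sum.inl a) => θ.1 i a
  | (i, Sum.inr (a, b)) => θ.2 i a b

/-- Algebraic identifiability: for general `θ ∈ Θ`, the value `M θ` determines `θ` within `Θ` up to
finitely many possibilities. "General" means: outside the zero set of some polynomial in the
entries of the parameters which does not vanish identically on `Θ`. -/
def AlgebraicallyIdentifiable {ι : Type} {n : ℕ} {K : Type} [CommRing K] {β : Type}
    (Θ : Set (Params ι n K)) (M : Params ι n K → β) : Prop :=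
  ∃ F : MvPolynomial (ι × (Fin n ⊕ Fin n × Fin n)) K,
    (∃ θ ∈ Θ, MvPolynomial.eval θ.coords F ≠ 0) ∧
    ∀ θ ∈ Θ, MvPolynomial.eval θ.coords F ≠ 0 → {θ' ∈ Θ | M θ' = M θ}.Finite

/-! ### The complex moment forms of degree 5 -/

/-- Complex parameters: arbitrary means, symmetric matrices. -/
def complexParams (ι : Type) (n : ℕ) : Set (Params ι n ℂ) :=
  {θ | ∀ i, (θ.2 i).IsSymm}

/-- The linear form `ℓ_μ(t) = tᵀ μ`. -/
def linForm {n : ℕ} (μ : Fin n → ℂ) : MvPolynomial (Fin n) ℂ :=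
  ∑ a, MvPolynomial.C (μ a) * MvPolynomial.X a

/-- The quadratic form `q_S(t) = tᵀ S t`. -/
def quadForm {n : ℕ} (S : Matrix (Fin n) (Fin n) ℂ) : MvPolynomial (Fin n) ℂ :=
  ∑ a, ∑ b, MvPolynomial.C (S a b) * (MvPolynomial.X a * MvPolynomial.X b)

/-- The degree-5 moment form of `N(μ, S)`. -/
def gaussianForm {n : ℕ} (μ : Fin n → ℂ) (S : Matrix (Fin n) (Fin n) ℂ) :
    MvPolynomial (Fin n) ℂ :=
  linForm μ ^ 5 + 10 * quadForm S * linForm μ ^ 3 + 15 * quadForm S ^ 2 * linForm μ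

/-- The degree-5 moment form of the symmetric multivariate Laplace distribution `L(μ, S)`. -/
def laplaceForm {n : ℕ} (μ : Fin n → ℂ) (S : Matrix (Fin n) (Fin n) ℂ) :
    MvPolynomial (Fin n) ℂ :=
  linForm μ ^ 5 + 10 * quadForm S * linForm μ ^ 3 + 30 * quadForm S ^ 2 * linForm μ

/-- The degree-5 moment form of the mixture, with mixing weights `w`, of the `r` Gaussians and `s`
Laplace distributions with parameters `θ`. -/
def mixtureForm {r s n : ℕ} (w : Fin r ⊕ Fin s → ℂ) (θ : Params (Fin r ⊕ Fin s) n ℂ) :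
    MvPolynomial (Fin n) ℂ :=
  (∑ i : Fin r, MvPolynomial.C (w (Sum.inl i)) *
      gaussianForm (θ.1 (Sum.inl i)) (θ.2 (Sum.inl i))) +
    ∑ j : Fin s, MvPolynomial.C (w (Sum.inr j)) *
      laplaceForm (θ.1 (Sum.inr j)) (θ.2 (Sum.inr j))

/-! ### The probability distributions and their moments -/

/-- Statistical parameters: real means, positive semidefinite covariance (or scale) matrices. -/
def realParams (ι : Type) (n : ℕ) : Set (Params ι n ℝ) :=
  {θ | ∀ i, (θ.2 i).PosSemidef}

/-- The symmetric multivariate Laplace distribution with mean `μ` and scale matrix `S`: the law of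
`μ + √W • X`, where `W` is exponential with mean `1` and `X` is centered Gaussian with covariance
`S`, independent of `W`. -/
def multivariateLaplace {n : ℕ} (μ : EuclideanSpace ℝ (Fin n)) (S : Matrix (Fin n) (Fin n) ℝ) :
    Measure (EuclideanSpace ℝ (Fin n)) :=
  ((expMeasure 1).prod (multivariateGaussian 0 S)).map fun p => μ + √p.1 • p.2

/-- The characteristic function of the symmetric multivariate Laplace distribution. -/
theorem charFun_multivariateLaplace {n : ℕ} (μ : EuclideanSpace ℝ (Fin n))
    {S : Matrix (Fin n) (Fin n) ℝ} (hS : S.PosSemidef) (t : EuclideanSpace ℝ (Fin n)) :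
    charFun (multivariateLaplace μ S) t =
      Complex.exp (Complex.I * (inner ℝ t μ : ℝ)) / (1 + ((t ⬝ᵥ S.mulVec t : ℝ) : ℂ) / 2) := by
  have hq : 0 ≤ t ⬝ᵥ S.mulVec t := by simpa using hS.dotProduct_mulVec_nonneg (t : Fin n → ℝ)
  set q : ℝ := t ⬝ᵥ S.mulVec t with hqdef
  have : IsProbabilityMeasure (expMeasure 1) := isProbabilityMeasure_expMeasure one_pos
  have hmeas : Measurable (fun p : ℝ × EuclideanSpace ℝ (Fin n) => μ + √p.1 • p.2) := by fun_prop
  rw [charFun_apply, multivariateLaplace, integral_map hmeas.aemeasurable (by fun_prop)]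
  rw [integral_prod]
  swap
  · refine (integrable_const (1 : ℝ)).mono' (by fun_prop) (ae_of_all _ fun p => ?_)
    rw [Complex.norm_exp_ofReal_mul_I]
  have h1 : ∀ x : ℝ, 0 ≤ x → ∫ y, Complex.exp ((inner ℝ (μ + √x • y) t : ℝ) * Complex.I)
      ∂(multivariateGaussian 0 S) =
      Complex.exp (Complex.I * (inner ℝ t μ : ℝ)) * Complex.exp (-(q / 2 : ℝ) * x) := by
    intro x hx
    have := charFun_multivariateGaussian (μ := 0) hS (√x • t)
    rw [charFun_apply] at this
    have e : ∀ y : EuclideanSpace ℝ (Fin n),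
        Complex.exp ((inner ℝ (μ + √x • y) t : ℝ) * Complex.I) =
        Complex.exp (Complex.I * (inner ℝ t μ : ℝ)) *
          Complex.exp ((inner ℝ y (√x • t) : ℝ) * Complex.I) := by
      intro y
      rw [← Complex.exp_add, inner_add_left, real_inner_smul_left, real_inner_smul_right,
        real_inner_comm]
      congr 1; push_cast; ring
    simp_rw [e]
    rw [integral_const_mul, this]
    congr 2
    have hs : (√x • t).ofLp ⬝ᵥ S.mulVec (√x • t).ofLp = x * q := by
      rw [WithLp.ofLp_smul, Matrix.mulVec_smul, smul_dotProduct, dotProduct_smul, smul_eq_mul,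
        smul_eq_mul, ← mul_assoc, Real.mul_self_sqrt hx]
    rw [hs]; simp; ring
  have h2 : ∀ f : ℝ → ℂ, ∫ x, f x ∂(expMeasure 1) =
      ∫ x in Set.Ioi (0:ℝ), (Real.exp (-x) : ℂ) * f x := by
    intro f
    rw [expMeasure, gammaMeasure, integral_withDensity_eq_integral_toReal_smul
      (by unfold gammaPDF; fun_prop) (ae_of_all _ fun x => by simp [gammaPDF]),
      ← integral_Ici_eq_integral_Ioi, ← integral_indicator measurableSet_Ici]
    congr 1; ext x
    by_cases hx : 0 ≤ x
    · simp [gammaPDF, gammaPDFReal, hx, Real.exp_nonneg]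
    · simp [gammaPDF, gammaPDFReal, hx]
  rw [h2]
  rw [setIntegral_congr_fun measurableSet_Ioi (g := fun x : ℝ =>
    Complex.exp (Complex.I * (inner ℝ t μ : ℝ)) *
      Complex.exp ((-(1 + q / 2 : ℝ) : ℂ) * x))]
  · rw [integral_const_mul, integral_exp_mul_complex_Ioi (by
      rw [← Complex.ofReal_neg, Complex.ofReal_re]; linarith)]
    simp [div_eq_mul_inv]
    rw [← mul_neg, ← inv_neg]; congr 2; ring
  · intro x hx
    simp only
    rw [h1 x (le_of_lt hx), Complex.ofReal_exp, mul_left_comm, ← Complex.exp_add]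
    congr 2; push_cast; ring

/-- The mixture, with mixing weights `w`, of the `r` Gaussians and `s` symmetric multivariate
Laplace distributions with parameters `θ`. -/
def mixture {r s n : ℕ} (w : Fin r ⊕ Fin s → ℝ) (θ : Params (Fin r ⊕ Fin s) n ℝ) :
    Measure (EuclideanSpace ℝ (Fin n)) :=
  (∑ i : Fin r, ENNReal.ofReal (w (Sum.inl i)) •
      multivariateGaussian (WithLp.toLp 2 (θ.1 (Sum.inl i))) (θ.2 (Sum.inl i))) +
    ∑ j : Fin s, ENNReal.ofReal (w (Sum.inr j)) •
      multivariateLaplace (WithLp.toLp 2 (θ.1 (Sum.inr j))) (θ.2 (Sum.inr j))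

/-- The moments of degree `d` of a measure `P`: all integrals `∫ y_{k 0} ⋯ y_{k (d-1)} dP(y)`. -/
def moments {n : ℕ} (d : ℕ) (P : Measure (EuclideanSpace ℝ (Fin n))) : (Fin d → Fin n) → ℝ :=
  fun k => ∫ y, ∏ j, y (k j) ∂P

end GaussLaplace

end

/-! Write `D` for the number of coordinates of one pair (mean, symmetric matrix) and `N =
(n+4).choose 5` for the dimension of the space of quintic forms. By the Jacobian criterion
(`exists_finite_fibres_of_jacobian`) it suffices that, at some parameter, the `r + s` tangent spaces
to the families of moment forms have dimension `D` each and a direct sum.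

The dimension of a sum of tangent spaces at general points depends only on the multiset of types
(Gaussian or Laplace). This function `typeRank` is monotone and submodular, with increments at most
`D`. Suppose that adding a point `p` to `S` gives a defect, i.e. the tangent space at `p` meets the
sum over `S`, and that the defect does not grow when any type from `S` is added again. Then the
intersection does not depend on the points of `S`, so it lies in the sum `W` over fresh copies of
them. Moving `p` and `S` by matrices while `W` stays fixed, and passing to the limit at a rank-one
matrix, puts every fifth power of a linear form into `W`; hence `W` has dimension at least `N`
(`choose_le_genRank_of_const`).

So, below `N`, a positive defect always grows. The counting argument `eq_card_mul_of_strict` then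
shows that no defect can occur while `(r + s) * D + D * D ≤ N`, which is the hypothesis with its
denominator cleared.

The real statement follows from the complex one. The fifth moments of the mixture determine its
moment form on real vectors, hence everywhere, and positive semidefinite real parameters are Zariski
dense in the complex ones. -/

namespace GaussLaplace

/-! ### Polynomial curves and generic rank -/

section Generic

variable {K : Type*} [Field K]

/-- The functions `K → K` which are given by a polynomial. -/
def IsPolyFun (f : K → K) : Prop := ∃ p : Polynomial K, ∀ z, f z = p.eval z

namespace IsPolyFun

lemma const (a : K) : IsPolyFun fun _ : K => a := ⟨Polynomial.C a, by simp⟩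

lemma id : IsPolyFun fun z : K => z := ⟨Polynomial.X, by simp⟩

lemma add {f g : K → K} (hf : IsPolyFun f) (hg : IsPolyFun g) :
    IsPolyFun fun z => f z + g z := by
  obtain ⟨p, hp⟩ := hf
  obtain ⟨q, hq⟩ := hg
  exact ⟨p + q, by simp [hp, hq]⟩

lemma mul {f g : K → K} (hf : IsPolyFun f) (hg : IsPolyFun g) :
    IsPolyFun fun z => f z * g z := by
  obtain ⟨p, hp⟩ := hf
  obtain ⟨q, hq⟩ := hg
  exact ⟨p * q, by simp [hp, hq]⟩

lemma pow {f : K → K} (hf : IsPolyFun f) (m : ℕ) : IsPolyFun fun z => f z ^ m := by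
  obtain ⟨p, hp⟩ := hf
  exact ⟨p ^ m, by simp [hp]⟩

lemma sum {κ : Type*} (s : Finset κ) {f : κ → K → K} (hf : ∀ i, IsPolyFun (f i)) :
    IsPolyFun fun z => ∑ i ∈ s, f i z := by
  choose p hp using hf
  exact ⟨∑ i ∈ s, p i, by simp [hp, Polynomial.eval_finsetSum]⟩

lemma finite_zeros {f : K → K} (hf : IsPolyFun f) {z₀ : K} (h : f z₀ ≠ 0) :
    {z | f z = 0}.Finite := by
  obtain ⟨p, hp⟩ := hf
  have hp0 : p ≠ 0 := by
    rintro rfl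
    simp [hp] at h
  exact (Polynomial.finite_setOfPred_isRoot hp0).subset fun z hz => (hp z).symm.trans hz

lemma det {κ : Type*} [Fintype κ] [DecidableEq κ] {A : K → Matrix κ κ K}
    (hA : ∀ i j, IsPolyFun fun z => A z i j) : IsPolyFun fun z => (A z).det := by
  choose p hp using hA
  refine ⟨(Matrix.of p).det, fun z => ?_⟩
  rw [← Polynomial.coe_evalRingHom, RingHom.map_det]
  refine congrArg Matrix.det (Matrix.ext fun i j => ?_)
  simp [hp]

end IsPolyFun

/-- Finitely many linearly independent functions can be separated by evaluation at as many
points. -/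
lemma exists_det_eval_ne_zero {κ X : Type*} [Fintype κ] [DecidableEq κ] {v : κ → X → K}
    (hv : LinearIndependent K v) :
    ∃ t : κ → X, (Matrix.of fun i j => v j (t i)).det ≠ 0 := by
  set R : Set (κ → K) := Set.range fun (t : X) (k : κ) => v k t with hR
  -- A functional vanishing on all vectors `(v k t)_k` is a linear relation among the `v k`. So
  -- these vectors span, and a basis can be selected from them.
  have hspan : Submodule.span K R = ⊤ := by
    by_contra hne
    obtain ⟨f, hf0, hf⟩ := Submodule.exists_le_ker_of_lt_top _ (lt_top_iff_ne_top.2 hne)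
    apply hf0
    have hfc : ∀ x : κ → K, f x = ∑ k, f (Pi.single k 1) * x k := by
      intro x
      rw [LinearMap.pi_apply_eq_sum_univ f x]
      exact Finset.sum_congr rfl fun k _ => by
        rw [smul_eq_mul, mul_comm]
        congr 2
        ext j
        simp [Pi.single_apply, eq_comm]
    have h0 := Fintype.linearIndependent_iff.1 hv (fun k => f (Pi.single k 1)) (by
      ext t
      have : f (fun k => v k t) = 0 := hf (Submodule.subset_span ⟨t, rfl⟩)
      rw [hfc] at this
      simpa using this)
    ext k
    simpa using h0 k
  obtain ⟨f, hfR, -, hfi⟩ := Submodule.exists_fun_fin_finrank_span_eq K R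
  have hcard : Module.finrank K (Submodule.span K R) = Fintype.card κ := by
    rw [hspan, finrank_top, Module.finrank_fintype_fun_eq_card]
  let e : κ ≃ Fin (Module.finrank K (Submodule.span K R)) :=
    Fintype.equivFinOfCardEq hcard.symm
  choose t ht using hfR
  refine ⟨t ∘ e, ?_⟩
  rw [← isUnit_iff_ne_zero, ← Matrix.isUnit_iff_isUnit_det,
    ← Matrix.linearIndependent_rows_iff_isUnit]
  have hrow : (Matrix.of fun i j => v j ((t ∘ e) i)).row = f ∘ e := by
    ext i j
    simp [← ht, Matrix.row]
  rw [hrow]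
  exact hfi.comp e e.injective

/-- The rank of a family of functions depending polynomially on `z` is lower semicontinuous in the
Zariski topology. -/
lemma finite_setOf_finrank_span_lt {J X : Type*} [Finite J] {v : K → J → X → K}
    (hv : ∀ j t, IsPolyFun fun z => v z j t) (z₀ : K) :
    {z | Module.finrank K (Submodule.span K (Set.range (v z))) <
      Module.finrank K (Submodule.span K (Set.range (v z₀)))}.Finite := by
  have hfin : ∀ z, FiniteDimensional K (Submodule.span K (Set.range (v z))) := fun z =>
    FiniteDimensional.span_of_finite K (Set.finite_range _)
  have := hfin z₀
  obtain ⟨f, hfR, -, hfi⟩ := Submodule.exists_fun_fin_finrank_span_eq K (Set.range (v z₀))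
  choose j hj using hfR
  -- A maximal independent subfamily at `z₀` has a nonzero minor. The same minor is polynomial in
  -- `z`, so it vanishes for finitely many `z` only.
  obtain ⟨t, ht⟩ := exists_det_eval_ne_zero hfi
  have hdet : IsPolyFun fun z => (Matrix.of fun i k => v z (j k) (t i)).det :=
    IsPolyFun.det fun i k => hv _ _
  refine (hdet.finite_zeros (z₀ := z₀) (by simpa only [hj] using ht)).subset fun z hz => ?_
  by_contra hne
  rw [Set.mem_ofPred_eq] at hz
  refine absurd hz (not_lt.2 ?_)
  have hli : LinearIndependent K fun k => v z (j k) := by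
    rw [Fintype.linearIndependent_iff]
    intro c hc
    have : (Matrix.of fun i k => v z (j k) (t i)).mulVec c = 0 := by
      ext i
      have := congrFun hc (t i)
      simpa [Matrix.mulVec, dotProduct, mul_comm] using this
    exact congrFun (Matrix.eq_zero_of_mulVec_eq_zero hne this)
  have hle : Submodule.span K (Set.range fun k => v z (j k)) ≤
      Submodule.span K (Set.range (v z)) :=
    Submodule.span_mono (by rintro _ ⟨k, rfl⟩; exact ⟨j k, rfl⟩)
  have := hfin z
  have h1 := Submodule.finrank_mono hle
  rw [finrank_span_eq_card hli, Fintype.card_fin] at h1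
  exact h1

end Generic

/-! ### Growth of the generic rank -/

section Growth

variable {τ : Type*} {f : Multiset τ → ℕ} {D N : ℕ}

lemma le_add_of_submodular
    (hmono : ∀ b m, f m ≤ f (b ::ₘ m))
    (hsub : ∀ b b' m, f (b ::ₘ b' ::ₘ m) + f m ≤ f (b ::ₘ m) + f (b' ::ₘ m))
    (b : τ) (m u : Multiset τ) : f (b ::ₘ (u + m)) + f m ≤ f (b ::ₘ m) + f (u + m) := by
  induction u using Multiset.induction_on with
  | empty => simp
  | cons a u ih =>
    have h1 := hsub b a (u + m)
    have h2 := hmono a (u + m)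
    simp only [Multiset.cons_add] at *
    omega

/-- By diminishing increments, each element of `u` adds no more later than it would add directly to
`m`. -/
lemma add_card_mul_le
    (hmono : ∀ b m, f m ≤ f (b ::ₘ m))
    (hsub : ∀ b b' m, f (b ::ₘ b' ::ₘ m) + f m ≤ f (b ::ₘ m) + f (b' ::ₘ m))
    {m u : Multiset τ} {e : ℕ} (hu : ∀ b ∈ u, f (b ::ₘ m) ≤ f m + e) :
    f (u + m) ≤ f m + Multiset.card u * e := by
  induction u using Multiset.induction_on with
  | empty => simp
  | cons a u ih =>
    have h1 := ih fun b hb => hu b (Multiset.mem_cons_of_mem hb)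
    have h2 := hu a (Multiset.mem_cons_self a u)
    have h3 := le_add_of_submodular hmono hsub a m u
    simp only [Multiset.cons_add, Multiset.card_cons, add_mul, one_mul] at *
    omega

/-- If the increments of a submodular function on multisets with at most two types of elements
strictly decrease as soon as they are smaller than `D`, until the value `N` is reached, then the
function takes its maximal value on multisets which are small compared to `N / D`. -/
theorem eq_card_mul_of_strict [DecidableEq τ]
    (h0 : f 0 = 0) (hmono : ∀ b m, f m ≤ f (b ::ₘ m)) (hD : ∀ b m, f (b ::ₘ m) ≤ f m + D)
    (hsub : ∀ b b' m, f (b ::ₘ b' ::ₘ m) + f m ≤ f (b ::ₘ m) + f (b' ::ₘ m))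
    (hstrict : ∀ b m, f m < N → f (b ::ₘ m) < f m + D →
      ∃ b' ∈ m, f (b ::ₘ b' ::ₘ m) + f m < f (b ::ₘ m) + f (b' ::ₘ m))
    (m : Multiset τ) (htypes : m.toFinset.card ≤ 2)
    (hN : Multiset.card m * D + D * D ≤ N) : f m = Multiset.card m * D := by
  induction m using Multiset.strongInductionOn with
  | ih m ih =>
    by_contra hne
    have hle : ∀ m' : Multiset τ, f m' ≤ Multiset.card m' * D := by
      intro m'
      induction m' using Multiset.induction_on with
      | empty => simp [h0]
      | cons a u ih =>
        have := hD a u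
        simp only [Multiset.card_cons, add_mul, one_mul]
        omega
    have hlt : f m < Multiset.card m * D := lt_of_le_of_ne (hle m) hne
    -- Here `m` is a minimal counterexample: without one copy of `b` it attains the full value, so
    -- that copy added less than `D`, and by submodularity one more copy adds no more.
    have hdef : ∀ b ∈ m, f (b ::ₘ m) + 1 ≤ f m + D := by
      intro b hb
      obtain ⟨m', rfl⟩ := Multiset.exists_cons_of_mem hb
      have h1 := ih m' (Multiset.lt_cons_self m' b)
        ((Finset.card_le_card (Multiset.toFinset_subset.2 (Multiset.subset_cons m' b))).trans
          htypes) (by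
          simp only [Multiset.card_cons, add_mul, one_mul] at hN
          omega)
      have h2 := hsub b b m'
      simp only [Multiset.card_cons, add_mul, one_mul] at hlt
      omega
    set U : Multiset τ := m.toFinset.val with hU
    have hUm : ∀ b, b ∈ U ↔ b ∈ m := by simp [hU]
    have hUc : Multiset.card U ≤ 2 := htypes
    -- Each round adds one copy of every type of `m`. After `k` rounds all increments are at most `D
    -- - (k + 1)`. With at most two types, round `j` has added at most `2 (D - j)`, and these bounds
    -- sum to `2kD - k(k+1)`.
    have key : ∀ k, k ≤ D → (∀ b ∈ m, f (b ::ₘ (k • U + m)) + (k + 1) ≤ f (k • U + m) + D) ∧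
        f (k • U + m) + k * (k + 1) < Multiset.card m * D + 2 * k * D := by
      intro k
      induction k with
      | zero =>
        intro _
        simpa using ⟨hdef, hlt⟩
      | succ k ihk =>
        intro hk
        obtain ⟨h1, h2⟩ := ihk (by omega)
        have hmk : ∀ b, b ∈ k • U + m → b ∈ m := by
          intro b hb
          rcases Multiset.mem_add.1 hb with hb | hb
          · exact (hUm b).1 (Multiset.mem_of_mem_nsmul hb)
          · exact hb
        have hexp : (k + 1) • U + m = U + (k • U + m) := by
          rw [succ_nsmul', add_assoc]
        obtain ⟨e, rfl⟩ : ∃ e, D = k + 1 + e := ⟨D - (k + 1), by omega⟩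
        -- The term `D * D` of `hN` is spent here: `2kD - k(k+1) ≤ D²`.
        have hfN : f (k • U + m) < N := by nlinarith
        rw [hexp]
        constructor
        · intro b hb
          obtain ⟨b', hb', hlt'⟩ := hstrict b (k • U + m) hfN (by have := h1 b hb; omega)
          -- The type `b'` that lowers the increment of `b` is one of those in `U`. Adding the rest
          -- of `U` cannot raise the increment again.
          obtain ⟨u, hu⟩ := Multiset.exists_cons_of_mem ((hUm b').2 (hmk b' hb'))
          have h3 := le_add_of_submodular hmono hsub b (b' ::ₘ (k • U + m)) u
          have h4 := h1 b hb
          rw [hu, Multiset.cons_add, ← Multiset.add_cons, ← hu]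
          omega
        · have h3 := add_card_mul_le hmono hsub (m := k • U + m) (u := U) (e := e) (by
            intro b hb
            have := h1 b ((hUm b).1 hb)
            omega)
          have h4 : Multiset.card U * e ≤ 2 * e := Nat.mul_le_mul_right _ hUc
          nlinarith
    have hm0 : m ≠ 0 := by
      rintro rfl
      simp at hlt
    obtain ⟨b, hb⟩ := Multiset.exists_mem_of_ne_zero hm0
    -- After `D` rounds the bound on the increment is `-1`, against monotonicity.
    have h1 := (key D le_rfl).1 b hb
    have h2 := hmono b (D • U + m)
    omega

end Growth

/-! ### Sums of tangent spaces at general points -/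

section TangentSum

variable {K : Type*} [Field K] {τ σ X : Type*}

/-- The sum of the tangent spaces `range (T c (x (c, k)))` for `(c, k) ∈ S`. -/
def tangentSum (T : τ → (σ → K) → (σ → K) →ₗ[K] X → K) (S : Finset (τ × ℕ))
    (x : τ × ℕ → σ → K) : Submodule K (X → K) :=
  ⨆ s ∈ S, LinearMap.range (T s.1 (x s))

/-- The dimension of a sum of tangent spaces at general points. -/
noncomputable def genRank (T : τ → (σ → K) → (σ → K) →ₗ[K] X → K) (S : Finset (τ × ℕ)) : ℕ :=
  sSup (Set.range fun x => Module.finrank K (tangentSum T S x))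

/-- The family `x` is general with respect to all subsets of `B`. -/
def IsGood (T : τ → (σ → K) → (σ → K) →ₗ[K] X → K) (B : Finset (τ × ℕ))
    (x : τ × ℕ → σ → K) : Prop :=
  ∀ S ⊆ B, Module.finrank K (tangentSum T S x) = genRank T S

variable {T : τ → (σ → K) → (σ → K) →ₗ[K] X → K} {S S' B : Finset (τ × ℕ)}

lemma tangentSum_mono (h : S ⊆ S') (x : τ × ℕ → σ → K) :
    tangentSum T S x ≤ tangentSum T S' x :=
  biSup_mono fun _ hs => h hs

lemma tangentSum_congr {x y : τ × ℕ → σ → K} (h : ∀ s ∈ S, x s = y s) :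
    tangentSum T S x = tangentSum T S y :=
  iSup_congr fun s => iSup_congr fun hs => by rw [h s hs]

lemma tangentSum_insert [DecidableEq τ] (p : τ × ℕ) (S : Finset (τ × ℕ)) (x : τ × ℕ → σ → K) :
    tangentSum T (insert p S) x = LinearMap.range (T p.1 (x p)) ⊔ tangentSum T S x :=
  Finset.iSup_insert _ _ _

lemma tangentSum_singleton (p : τ × ℕ) (x : τ × ℕ → σ → K) :
    tangentSum T {p} x = LinearMap.range (T p.1 (x p)) :=
  Finset.iSup_singleton _ _

variable [Fintype σ]

lemma tangentSum_eq_span [DecidableEq σ] (S : Finset (τ × ℕ)) (x : τ × ℕ → σ → K) :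
    tangentSum T S x =
      Submodule.span K (Set.range fun s : S × σ => T s.1.1.1 (x s.1) (Pi.single s.2 1)) := by
  have h : ∀ s : τ × ℕ, LinearMap.range (T s.1 (x s)) =
      Submodule.span K (Set.range fun j => T s.1 (x s) (Pi.single j 1)) := by
    intro s
    rw [LinearMap.range_eq_map, ← (Pi.basisFun K σ).span_eq, Submodule.map_span, ← Set.range_comp]
    congr 2
    ext1 j
    simp
  unfold tangentSum
  simp_rw [h]
  rw [iSup_subtype', ← Submodule.span_iUnion]
  congr 1
  ext v
  simp

instance (S : Finset (τ × ℕ)) (x : τ × ℕ → σ → K) :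
    FiniteDimensional K (tangentSum T S x) := by
  classical
  rw [tangentSum_eq_span]
  exact FiniteDimensional.span_of_finite K (Set.finite_range _)

lemma finrank_tangentSum_le (S : Finset (τ × ℕ)) (x : τ × ℕ → σ → K) :
    Module.finrank K (tangentSum T S x) ≤ S.card * Fintype.card σ := by
  classical
  rw [tangentSum_eq_span]
  refine (finrank_range_le_card _).trans ?_
  simp

lemma finrank_le_genRank (S : Finset (τ × ℕ)) (x : τ × ℕ → σ → K) :
    Module.finrank K (tangentSum T S x) ≤ genRank T S :=
  le_csSup ⟨S.card * Fintype.card σ, by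
    rintro _ ⟨x, rfl⟩
    exact finrank_tangentSum_le S x⟩ ⟨x, rfl⟩

lemma exists_finrank_eq_genRank (T : τ → (σ → K) → (σ → K) →ₗ[K] X → K) (S : Finset (τ × ℕ)) :
    ∃ x, Module.finrank K (tangentSum T S x) = genRank T S :=
  Nat.sSup_mem (s := Set.range fun x => Module.finrank K (tangentSum T S x))
    ⟨_, 0, rfl⟩ ⟨S.card * Fintype.card σ, by
      rintro _ ⟨x, rfl⟩
      exact finrank_tangentSum_le S x⟩

/-- The map `T` depends polynomially on the point. -/
def IsPolyFamily (T : τ → (σ → K) → (σ → K) →ₗ[K] X → K) : Prop :=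
  ∀ c (γ : K → σ → K), (∀ j, IsPolyFun fun z => γ z j) → ∀ v t, IsPolyFun fun z => T c (γ z) v t

lemma finite_setOf_finrank_tangentSum_lt (hT : IsPolyFamily T) (S : Finset (τ × ℕ))
    {γ : K → τ × ℕ → σ → K} (hγ : ∀ s j, IsPolyFun fun z => γ z s j) (z₀ : K) :
    {z | Module.finrank K (tangentSum T S (γ z)) <
      Module.finrank K (tangentSum T S (γ z₀))}.Finite := by
  classical
  refine (finite_setOf_finrank_span_lt (J := S × σ)
    (v := fun z s => T s.1.1.1 (γ z s.1) (Pi.single s.2 1))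
    (fun s t => hT _ _ (hγ _) _ _) z₀).subset fun z hz => ?_
  rw [Set.mem_ofPred_eq, tangentSum_eq_span, tangentSum_eq_span] at hz
  exact hz

lemma finite_setOf_not_isGood (hT : IsPolyFamily T) {γ : K → τ × ℕ → σ → K}
    (hγ : ∀ s j, IsPolyFun fun z => γ z s j) {z₀ : K} (h : IsGood T B (γ z₀)) :
    {z | ¬ IsGood T B (γ z)}.Finite := by
  have hfin : (⋃ S ∈ B.powerset, {z | Module.finrank K (tangentSum T S (γ z)) <
      Module.finrank K (tangentSum T S (γ z₀))}).Finite :=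
    Set.Finite.biUnion B.powerset.finite_toSet
      fun S _ => finite_setOf_finrank_tangentSum_lt hT S hγ z₀
  refine hfin.subset fun z hz => ?_
  rw [Set.mem_ofPred_eq, IsGood] at hz
  push Not at hz
  obtain ⟨S, hS, hne⟩ := hz
  simp only [Set.mem_iUnion, Finset.mem_powerset]
  exact ⟨S, hS, by rw [Set.mem_ofPred_eq, h S hS]; exact lt_of_le_of_ne (finrank_le_genRank S _) hne⟩

/-- Join a family that is general for the sets already treated to one that is optimal for the next
set by a line. Each rank condition fails at finitely many points of the line, and `K` is infinite.
-/
lemma exists_isGood [Infinite K] (hT : IsPolyFamily T) (B : Finset (τ × ℕ)) :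
    ∃ x, IsGood T B x := by
  classical
  suffices h : ∀ F : Finset (Finset (τ × ℕ)),
      ∃ x, ∀ S ∈ F, Module.finrank K (tangentSum T S x) = genRank T S by
    obtain ⟨x, hx⟩ := h B.powerset
    exact ⟨x, fun S hS => hx S (Finset.mem_powerset.2 hS)⟩
  intro F
  induction F using Finset.induction_on with
  | empty => exact ⟨0, by simp⟩
  | insert S F hS ih =>
    obtain ⟨x, hx⟩ := ih
    obtain ⟨y, hy⟩ := exists_finrank_eq_genRank T S
    let γ : K → τ × ℕ → σ → K := fun z s j => x s j + z * (y s j - x s j)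
    have hγ : ∀ s j, IsPolyFun fun z => γ z s j := fun s j =>
      (IsPolyFun.const _).add (IsPolyFun.id.mul (IsPolyFun.const _))
    have h0 : γ 0 = x := by ext; simp [γ]
    have h1 : γ 1 = y := by ext; simp [γ]
    have hfin : ((⋃ S ∈ F, {z | Module.finrank K (tangentSum T S (γ z)) <
        Module.finrank K (tangentSum T S (γ 0))}) ∪ {z | Module.finrank K (tangentSum T S (γ z)) <
        Module.finrank K (tangentSum T S (γ 1))}).Finite :=
      (Set.Finite.biUnion F.finite_toSet
        fun S _ => finite_setOf_finrank_tangentSum_lt hT S hγ 0).union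
        (finite_setOf_finrank_tangentSum_lt hT S hγ 1)
    obtain ⟨z, hz⟩ := hfin.exists_notMem
    simp only [Set.mem_union, Set.mem_iUnion, Set.mem_ofPred_eq, not_or, not_exists, not_lt] at hz
    rw [h1] at hz
    refine ⟨γ z, fun S' hS' => le_antisymm (finrank_le_genRank S' _) ?_⟩
    rcases Finset.mem_insert.1 hS' with rfl | hS'
    · exact hy ▸ hz.2
    · have := hz.1 S' hS'
      rw [h0, hx S' hS'] at this
      exact this

lemma genRank_mono [Infinite K] (hT : IsPolyFamily T) (h : S ⊆ S') :
    genRank T S ≤ genRank T S' := by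
  obtain ⟨x, hx⟩ := exists_isGood hT S'
  rw [← hx S h, ← hx S' subset_rfl]
  exact Submodule.finrank_mono (tangentSum_mono h x)

lemma genRank_le_card_mul (S : Finset (τ × ℕ)) : genRank T S ≤ S.card * Fintype.card σ := by
  obtain ⟨x, hx⟩ := exists_finrank_eq_genRank T S
  exact hx ▸ finrank_tangentSum_le S x

/-- The second components are mere labels: a type-preserving bijection from `S` to `S'` transports
an optimal family. -/
lemma genRank_le_of_map_eq (h : S.val.map Prod.fst = S'.val.map Prod.fst) :
    genRank T S ≤ genRank T S' := by
  classical
  obtain ⟨x, hx⟩ := exists_finrank_eq_genRank T S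
  have hcard : ∀ c : τ, Nonempty ({s : S // s.1.1 = c} ≃ {s : S' // s.1.1 = c}) := by
    intro c
    refine ⟨Fintype.equivOfCardEq ?_⟩
    have hcount : ∀ R : Finset (τ × ℕ), Fintype.card {s : R // s.1.1 = c} =
        (R.val.map Prod.fst).count c := by
      intro R
      rw [Multiset.count_map, Fintype.card_subtype, ← Finset.card_map
        (Function.Embedding.subtype _)]
      rw [← Finset.filter_val, Finset.card_val]
      congr 1
      ext ⟨b, k⟩
      simp [eq_comm, and_comm]
    rw [hcount, hcount, h]
  let e : S ≃ S' := (Equiv.sigmaFiberEquiv fun s : S => s.1.1).symm.trans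
    ((Equiv.sigmaCongrRight fun c => (hcard c).some).trans
      (Equiv.sigmaFiberEquiv fun s : S' => s.1.1))
  have he : ∀ s, (e s).1.1 = s.1.1 := fun s =>
    ((hcard s.1.1).some ⟨s, rfl⟩).2
  let y : τ × ℕ → σ → K := fun s => if hs : s ∈ S' then x (e.symm ⟨s, hs⟩) else 0
  have hy : tangentSum T S' y = tangentSum T S x := by
    unfold tangentSum
    rw [iSup_subtype', iSup_subtype', ← e.iSup_comp]
    refine iSup_congr fun s => ?_
    have : y (e s) = x s := by simp [y]
    rw [this, he]
  rw [← hx, ← hy]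
  exact finrank_le_genRank _ _

lemma genRank_congr (h : S.val.map Prod.fst = S'.val.map Prod.fst) :
    genRank T S = genRank T S' :=
  le_antisymm (genRank_le_of_map_eq h) (genRank_le_of_map_eq h.symm)

variable [DecidableEq τ]

lemma genRank_insert_le (p : τ × ℕ) (S : Finset (τ × ℕ)) :
    genRank T (insert p S) ≤ genRank T S + Fintype.card σ := by
  obtain ⟨x, hx⟩ := exists_finrank_eq_genRank T (insert p S)
  have h1 := Submodule.finrank_add_le_finrank_add_finrank
    (LinearMap.range (T p.1 (x p))) (tangentSum T S x)
  have h2 : Module.finrank K (LinearMap.range (T p.1 (x p))) ≤ Fintype.card σ :=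
    (LinearMap.finrank_range_le _).trans (by simp)
  have h3 := finrank_le_genRank (T := T) S x
  rw [tangentSum_insert] at hx
  omega

/-- At one family general for all four sets this is the dimension formula for the sums over `insert
p S` and `insert q S`, whose intersection contains the sum over `S`. -/
lemma genRank_submodular [Infinite K] (hT : IsPolyFamily T) (p q : τ × ℕ) (S : Finset (τ × ℕ)) :
    genRank T (insert p (insert q S)) + genRank T S ≤
      genRank T (insert p S) + genRank T (insert q S) := by
  obtain ⟨x, hx⟩ := exists_isGood hT (insert p (insert q S))
  rw [← hx _ subset_rfl, ← hx S (by grind), ← hx (insert p S) (by grind),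
    ← hx (insert q S) (by grind), ← Submodule.finrank_sup_add_finrank_inf_eq
      (tangentSum T (insert p S) x)]
  gcongr
  · refine Submodule.finrank_mono ?_
    rw [tangentSum_insert, tangentSum_insert, tangentSum_insert]
    exact sup_le (le_sup_left.trans le_sup_left) le_sup_right
  · refine Submodule.finrank_mono ?_
    exact le_inf (tangentSum_mono (Finset.subset_insert _ _) x)
      (tangentSum_mono (Finset.subset_insert _ _) x)

/-- The defect caused by adding `p` to `S` is the dimension of this intersection. -/
lemma IsGood.finrank_inf_add {x : τ × ℕ → σ → K} (hx : IsGood T B x) {p : τ × ℕ}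
    (hp : insert p S ⊆ B) :
    Module.finrank K (LinearMap.range (T p.1 (x p)) ⊓ tangentSum T S x : Submodule K (X → K)) +
      genRank T (insert p S) = genRank T {p} + genRank T S := by
  rw [← hx _ hp, ← hx {p} (by grind), ← hx S (by grind), tangentSum_insert, tangentSum_singleton,
    add_comm]
  exact Submodule.finrank_sup_add_finrank_inf_eq _ _

/-- If the intersection of the tangent space at a general point with the span of the tangent
spaces at the points of `S` does not grow when a further point is added, then it does not depend
on the points of `S`. -/
lemma IsGood.inf_le_tangentSum_image {x : τ × ℕ → σ → K} {p : τ × ℕ} {e : τ × ℕ → τ × ℕ}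
    (hx : IsGood T (insert p (S ∪ S.image e)) x) (he : ∀ s, (e s).1 = s.1)
    (hinj : Function.Injective e)
    (hdisj : ∀ s ∈ S, e s ∉ S) (hp : ∀ s ∈ S, p ≠ s ∧ p ≠ e s)
    (hconst : ∀ s ∈ S, genRank T (insert p (insert (e s) S)) + genRank T S =
      genRank T (insert p S) + genRank T (insert (e s) S)) :
    LinearMap.range (T p.1 (x p)) ⊓ tangentSum T S x ≤ tangentSum T (S.image e) x := by
  set E : Finset (τ × ℕ) → Submodule K (X → K) :=
    fun Y => LinearMap.range (T p.1 (x p)) ⊓ tangentSum T Y x with hE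
  have hfd : ∀ Y, FiniteDimensional K (E Y) := fun Y =>
    Submodule.finiteDimensional_of_le (inf_le_right : E Y ≤ tangentSum T Y x)
  have hEmono : ∀ {Y Y'}, Y ⊆ Y' → E Y ≤ E Y' := fun h =>
    inf_le_inf_left _ (tangentSum_mono h x)
  have hmapi : ∀ {q : τ × ℕ} {Y : Finset (τ × ℕ)}, q ∉ Y →
      (insert q Y).val.map Prod.fst = q.1 ::ₘ Y.val.map Prod.fst := fun h => by
    rw [Finset.insert_val_of_notMem h, Multiset.map_cons]
  -- The points of `S` are exchanged for their fresh copies one at a time; `A` is the set already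
  -- exchanged.
  suffices h : ∀ A ⊆ S, E S ≤ E ((S \ A) ∪ A.image e) by
    have := h S subset_rfl
    rw [Finset.sdiff_self, Finset.empty_union] at this
    exact this.trans inf_le_right
  intro A
  induction A using Finset.induction_on with
  | empty => simp
  | insert a A ha ih =>
    intro hA
    have haS : a ∈ S := hA (Finset.mem_insert_self a A)
    have hAS : A ⊆ S := (Finset.subset_insert a A).trans hA
    refine (ih hAS).trans ?_
    set Y := (S \ A) ∪ A.image e with hY
    set Y' := (S \ insert a A) ∪ (insert a A).image e with hY'
    -- Consecutive stages `Y` and `Y'` lie in a common set with one more point, where their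
    -- intersections `E` are compared.
    have hYY' : insert (e a) Y = insert a Y' := by
      ext s
      simp only [hY, hY', Finset.mem_insert, Finset.mem_union, Finset.mem_sdiff,
        Finset.image_insert]
      by_cases h : s = a
      · subst h; simp [haS, ha]
      · simp [h]; tauto
    have hmapA : ∀ A ⊆ S, ((S \ A) ∪ A.image e).val.map Prod.fst = S.val.map Prod.fst := by
      intro A
      induction A using Finset.induction_on with
      | empty => simp
      | insert a A ha ih =>
        intro hA
        have haS : a ∈ S := hA (Finset.mem_insert_self a A)
        have hAS : A ⊆ S := (Finset.subset_insert a A).trans hA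
        rw [← ih hAS]
        have h1 : S \ A = insert a (S \ insert a A) := by
          ext s; by_cases h : s = a
          · subst h; simp [haS, ha]
          · simp [h]
        rw [h1, Finset.image_insert, Finset.insert_union, Finset.union_insert, hmapi, hmapi, he]
        · simp only [Finset.mem_union, Finset.mem_sdiff, Finset.mem_insert, Finset.mem_image]
          rintro (h | ⟨s, hs, h⟩)
          · simp at h
          · exact hdisj s (hAS hs) (h ▸ haS)
        · simp only [Finset.mem_union, Finset.mem_sdiff, Finset.mem_image]
          rintro (h | ⟨s, hs, h⟩)
          · exact hdisj a haS h.1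
          · exact ha (hinj h ▸ hs)
    have hY1 := hmapA A hAS
    have hY2 := hmapA _ hA
    have heaY : e a ∉ Y := by
      simp only [hY, Finset.mem_union, Finset.mem_sdiff, Finset.mem_image]
      rintro (h | ⟨s, hs, h⟩)
      · exact hdisj a haS h.1
      · exact ha (hinj h ▸ hs)
    have hpY : ∀ A ⊆ S, p ∉ (S \ A) ∪ A.image e := by
      intro A hA h
      simp only [Finset.mem_union, Finset.mem_sdiff, Finset.mem_image] at h
      rcases h with h | ⟨s, hs, h⟩
      · exact (hp p h.1).1 rfl
      · exact (hp s (hA hs)).2 h.symm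
    have hpS : p ∉ S := fun h => (hp p h).1 rfl
    have hsub : ∀ A ⊆ S, (S \ A) ∪ A.image e ⊆ S ∪ S.image e := fun A hA =>
      Finset.union_subset_union Finset.sdiff_subset (Finset.image_subset_image hA)
    have hea : insert (e a) Y ⊆ S ∪ S.image e :=
      Finset.insert_subset (Finset.mem_union_right _ (Finset.mem_image_of_mem e haS))
        (hsub A hAS)
    have d1 : Module.finrank K (E Y) + genRank T (insert p Y) = genRank T {p} + genRank T Y := hx.finrank_inf_add (Finset.insert_subset_insert p (hsub A hAS))
    have d2 : Module.finrank K (E Y') + genRank T (insert p Y') =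
        genRank T {p} + genRank T Y' := hx.finrank_inf_add (Finset.insert_subset_insert p (hsub _ hA))
    have d3 : Module.finrank K (E (insert (e a) Y)) + genRank T (insert p (insert (e a) Y)) =
        genRank T {p} + genRank T (insert (e a) Y) := hx.finrank_inf_add (Finset.insert_subset_insert p hea)
    have g1 : genRank T Y = genRank T S := genRank_congr hY1
    have g2 : genRank T Y' = genRank T S := genRank_congr hY2
    have g3 : genRank T (insert p Y) = genRank T (insert p S) := genRank_congr (by
      rw [hmapi (hpY A hAS), hmapi hpS, hY1])
    have g4 : genRank T (insert p Y') = genRank T (insert p S) := genRank_congr (by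
      rw [hmapi (hpY _ hA), hmapi hpS, hY2])
    have g5 : genRank T (insert (e a) Y) = genRank T (insert (e a) S) := genRank_congr (by
      rw [hmapi heaY, hmapi (hdisj a haS), hY1])
    have g6 : genRank T (insert p (insert (e a) Y)) = genRank T (insert p (insert (e a) S)) :=
      genRank_congr (by
        rw [hmapi, hmapi heaY, hY1, hmapi, hmapi (hdisj a haS)]
        · rw [Finset.mem_insert, not_or]
          exact ⟨(hp a haS).2, hpS⟩
        · rw [Finset.mem_insert, not_or]
          exact ⟨(hp a haS).2, hpY A hAS⟩)
    have hc := hconst a haS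
    -- Only types matter for ranks, so `hconst` for `S` gives the same dimension for `E Y`, `E Y'`
    -- and `E (insert (e a) Y)`; inclusion makes them equal.
    have e1 : E Y = E (insert (e a) Y) := by
      refine Submodule.eq_of_le_of_finrank_eq (hEmono (Finset.subset_insert _ _)) ?_
      omega
    have e2 : E Y' = E (insert (e a) Y) := by
      refine Submodule.eq_of_le_of_finrank_eq (hEmono (hYY' ▸ Finset.subset_insert _ _)) ?_
      omega
    rw [e1, e2]

/-- Moving the points along a polynomial curve of symmetries. -/
lemma IsGood.comp_mem_tangentSum_image [Infinite K] (hT : IsPolyFamily T) {x : τ × ℕ → σ → K}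
    {p : τ × ℕ} {e : τ × ℕ → τ × ℕ}
    (hx : IsGood T (insert p (S ∪ S.image e)) x) (he : ∀ s, (e s).1 = s.1)
    (hinj : Function.Injective e)
    (hdisj : ∀ s ∈ S, e s ∉ S) (hp : ∀ s ∈ S, p ≠ s ∧ p ≠ e s)
    (hconst : ∀ s ∈ S, genRank T (insert p (insert (e s) S)) + genRank T S =
      genRank T (insert p S) + genRank T (insert (e s) S))
    {A : K → X → X} {Φ : K → (σ → K) → σ → K} (hΦ0 : ∀ x, Φ 0 x = x)
    (hΦ : ∀ x j, IsPolyFun fun z => Φ z x j)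
    (hA : ∀ c x v t, IsPolyFun fun z => T c x v (A z t))
    (hAΦ : ∀ z c x v, T c (Φ z x) (Φ z v) = T c x v ∘ A z)
    {v : X → K} (hv : v ∈ LinearMap.range (T p.1 (x p)) ⊓ tangentSum T S x) (z₁ : K) :
    v ∘ A z₁ ∈ tangentSum T (S.image e) x := by
  classical
  set W := tangentSum T (S.image e) x with hW
  -- The fresh copies stay put, and with them `W`, while `p` and the points of `S` move.
  let γ : K → τ × ℕ → σ → K := fun z s => if s ∈ S.image e then x s else Φ z (x s)
  have hγ : ∀ s j, IsPolyFun fun z => γ z s j := by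
    intro s j
    by_cases h : s ∈ S.image e
    · simpa only [γ, if_pos h] using IsPolyFun.const _
    · simpa only [γ, if_neg h] using hΦ _ _
  have hγ0 : γ 0 = x := by
    ext s
    simp [γ, hΦ0]
  have hSe : ∀ s ∈ S, s ∉ S.image e := by
    intro s hs h
    obtain ⟨s', hs', rfl⟩ := Finset.mem_image.1 h
    exact hdisj s' hs' hs
  have hpe : p ∉ S.image e := by
    intro h
    obtain ⟨s', hs', h⟩ := Finset.mem_image.1 h
    exact (hp s' hs').2 h.symm
  have hfin := finite_setOf_not_isGood hT hγ (z₀ := 0) (by rwa [hγ0])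
  have hmap : ∀ z s u, u ∈ LinearMap.range (T s.1 (x s)) → s ∉ S.image e →
      u ∘ A z ∈ LinearMap.range (T s.1 (γ z s)) := by
    rintro z s _ ⟨v, rfl⟩ hs
    exact ⟨Φ z v, by simp only [γ, if_neg hs]; exact hAΦ z s.1 (x s) v⟩
  -- For general `z` the moved family is still good, so its intersection, which contains `v ∘ A z`,
  -- lies in the unmoved space `W`.
  have hmem : ∀ z, IsGood T (insert p (S ∪ S.image e)) (γ z) → v ∘ A z ∈ W := by
    intro z hz
    have h1 := hz.inf_le_tangentSum_image he hinj hdisj hp hconst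
    have h2 : tangentSum T (S.image e) (γ z) = W :=
      tangentSum_congr fun s hs => by simp only [γ, if_pos hs]
    rw [← h2]
    refine h1 ⟨hmap z p v hv.1 hpe, ?_⟩
    have h3 : tangentSum T S x ≤ (tangentSum T S (γ z)).comap (LinearMap.funLeft K K (A z)) :=
      iSup₂_le fun s hs u hu => Submodule.mem_comap.2 <|
        (le_iSup₂_of_le (f := fun s (_ : s ∈ S) => LinearMap.range (T s.1 (γ z s))) s hs le_rfl)
          (hmap z s u hu (hSe s hs))
    exact h3 hv.2
  obtain ⟨v₀, rfl⟩ := hv.1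
  let w : K → Option (S.image e × σ) → X → K := fun z o => match o with
    | none => T p.1 (x p) v₀ ∘ A z
    | some s => T s.1.1.1 (x s.1) (Pi.single s.2 1)
  have hspan : ∀ z, Submodule.span K (Set.range (w z)) =
      Submodule.span K {T p.1 (x p) v₀ ∘ A z} ⊔ W := by
    intro z
    rw [hW, tangentSum_eq_span, ← Submodule.span_union]
    congr 1
    ext u
    simp only [Set.mem_range, Option.exists, w, Set.mem_union, Set.mem_singleton_iff]
    simp [eq_comm]
  have hw : ∀ o t, IsPolyFun fun z => w z o t := by
    rintro (_ | s) t
    · exact hA _ _ _ _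
    · exact IsPolyFun.const _
  -- Membership in `W` is a closed condition: if `v ∘ A z₁` enlarged `W`, then so would `v ∘ A z`
  -- for general `z`. This reaches values `z₁` at which the family is no longer good.
  obtain ⟨z, hz⟩ := (hfin.union (finite_setOf_finrank_span_lt hw z₁)).exists_notMem
  simp only [Set.mem_union, Set.mem_ofPred_eq, not_or, not_not, not_lt] at hz
  obtain ⟨hz1, hz2⟩ := hz
  rw [hspan, hspan, sup_eq_right.2 ((Submodule.span_singleton_le_iff_mem _ _).2 (hmem z hz1))]
    at hz2
  have : FiniteDimensional K
      (Submodule.span K {T p.1 (x p) v₀ ∘ A z₁} ⊔ W : Submodule K (X → K)) :=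
    Submodule.finiteDimensional_sup _ _
  have := Submodule.eq_of_le_of_finrank_le (le_sup_right :
    W ≤ Submodule.span K {T p.1 (x p) v₀ ∘ A z₁} ⊔ W) hz2
  rw [this]
  exact Submodule.mem_sup_left (Submodule.mem_span_singleton_self _)

end TangentSum

/-! ### Powers of linear forms -/

section Powers

variable {n : ℕ}

lemma card_piAntidiag_fin (n d : ℕ) :
    (Finset.piAntidiag (Finset.univ : Finset (Fin n)) d).card = (n + d - 1).choose d := by
  have := Finset.card_finsuppAntidiag_nat_eq_choose (s := (Finset.univ : Finset (Fin n))) d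
  simpa [Finset.finsuppAntidiag] using this

lemma linearIndependent_monomials {K : Type*} [Field K] [Infinite K] (n d : ℕ) :
    LinearIndependent K
      fun (α : Finset.piAntidiag (Finset.univ : Finset (Fin n)) d) (t : Fin n → K) =>
        ∏ i, t i ^ α.1 i := by
  rw [Fintype.linearIndependent_iff]
  intro c hc α
  have h : ∑ β : Finset.piAntidiag (Finset.univ : Finset (Fin n)) d,
      MvPolynomial.monomial (Finsupp.equivFunOnFinite.symm β.1) (c β) = 0 := by
    refine MvPolynomial.funext fun t => ?_
    have := congrFun hc t
    simp only [Finset.sum_apply, Pi.smul_apply, smul_eq_mul, Pi.zero_apply] at this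
    rw [map_sum, map_zero, ← this]
    refine Finset.sum_congr rfl fun β _ => ?_
    rw [MvPolynomial.eval_monomial, Finsupp.prod_fintype _ _ (by simp)]
    simp
  have h2 := congrArg (MvPolynomial.coeff (Finsupp.equivFunOnFinite.symm α.1)) h
  rw [MvPolynomial.coeff_sum, MvPolynomial.coeff_zero, Finset.sum_eq_single α] at h2
  · simpa using h2
  · intro β _ hβ
    rw [MvPolynomial.coeff_monomial, if_neg]
    exact fun h => hβ (Subtype.ext (Finsupp.equivFunOnFinite.symm.injective h))
  · simp

/-- The `d`-th powers of linear forms span the space of all forms of degree `d`. -/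
lemma choose_le_finrank_of_powers_mem {K : Type*} [Field K] [CharZero K] {d : ℕ}
    {W : Submodule K ((Fin n → K) → K)} [FiniteDimensional K W]
    (hW : ∀ q : Fin n → K, (fun t => (q ⬝ᵥ t) ^ d) ∈ W) :
    (n + d - 1).choose d ≤ Module.finrank K W := by
  classical
  have hli := linearIndependent_monomials (K := K) n d
  -- By the multinomial theorem, the coefficients of the powers `(q i ⬝ᵥ t) ^ d` form this
  -- invertible matrix of monomial values with columns scaled by multinomial coefficients, which are
  -- nonzero in characteristic zero.
  obtain ⟨q, hq⟩ := exists_det_eval_ne_zero hli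
  have hpow : ∀ i, (fun t : Fin n → K => (q i ⬝ᵥ t) ^ d) =
      ∑ α : Finset.piAntidiag (Finset.univ : Finset (Fin n)) d,
        ((Nat.multinomial Finset.univ α.1 : K) * ∏ k, q i k ^ α.1 k) •
          fun t : Fin n → K => ∏ k, t k ^ α.1 k := by
    intro i
    ext t
    rw [dotProduct, Finset.sum_pow_eq_sum_piAntidiag, Finset.sum_apply,
      ← Finset.sum_coe_sort]
    refine Finset.sum_congr rfl fun α _ => ?_
    simp only [Pi.smul_apply, smul_eq_mul, mul_pow, Finset.prod_mul_distrib]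
    ring
  have hind : LinearIndependent K
      fun (i : Finset.piAntidiag (Finset.univ : Finset (Fin n)) d) (t : Fin n → K) =>
        (q i ⬝ᵥ t) ^ d := by
    rw [Fintype.linearIndependent_iff]
    intro c hc
    simp_rw [hpow, Finset.smul_sum] at hc
    rw [Finset.sum_comm] at hc
    simp_rw [smul_smul, ← Finset.sum_smul] at hc
    have h0 := Fintype.linearIndependent_iff.1 hli _ hc
    refine congrFun (Matrix.eq_zero_of_vecMul_eq_zero hq (v := c) ?_)
    ext α
    have hm : (Nat.multinomial Finset.univ α.1 : K) ≠ 0 :=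
      Nat.cast_ne_zero.2 (Nat.multinomial_pos _ _).ne'
    have := h0 α
    simp_rw [mul_left_comm (c _)] at this
    rw [← Finset.mul_sum] at this
    simpa [Matrix.vecMul, dotProduct] using (mul_eq_zero.1 this).resolve_left hm
  have h1 := finrank_span_eq_card hind
  rw [Fintype.card_coe, card_piAntidiag_fin] at h1
  rw [← h1]
  refine Submodule.finrank_mono (Submodule.span_le.2 ?_)
  rintro _ ⟨i, rfl⟩
  exact hW _

end Powers

/-! ### The moment forms and their tangent spaces -/

section Forms

/-- The coordinates of a mean vector and a symmetric matrix. -/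
abbrev Coord (n : ℕ) : Type := Fin n ⊕ Sym2 (Fin n)

variable {R : Type*} {n : ℕ}

/-- The entry of a symmetric matrix at an unordered pair of indices. -/
noncomputable def symEntry (S : Matrix (Fin n) (Fin n) R) (e : Sym2 (Fin n)) : R :=
  S e.out.1 e.out.2

lemma symEntry_mk {S : Matrix (Fin n) (Fin n) R} (hS : S.IsSymm) (a b : Fin n) :
    symEntry S s(a, b) = S a b := by
  have h : s((s(a, b) : Sym2 (Fin n)).out.1, (s(a, b) : Sym2 (Fin n)).out.2) = s(a, b) :=
    Quot.out_eq _
  rcases Sym2.eq_iff.1 h with ⟨h1, h2⟩ | ⟨h1, h2⟩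
  · rw [symEntry, h1, h2]
  · rw [symEntry, h1, h2, hS.apply]

/-- The symmetric matrix with given coordinates. -/
def symMat (x : Coord n → R) : Matrix (Fin n) (Fin n) R := Matrix.of fun a b => x (.inr s(a, b))

lemma symMat_isSymm (x : Coord n → R) : (symMat x).IsSymm := by
  ext a b
  simp [symMat, Sym2.eq_swap]

variable [CommRing R]

/-- The linear form of a parameter, as a function. -/
def lin (x : Coord n → R) (t : Fin n → R) : R := (fun a => x (.inl a)) ⬝ᵥ t

/-- The quadratic form of a parameter, as a function. -/
def quad (x : Coord n → R) (t : Fin n → R) : R := t ⬝ᵥ (symMat x).mulVec t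

lemma lin_add (x y : Coord n → R) (t : Fin n → R) : lin (x + y) t = lin x t + lin y t := by
  simp [lin, dotProduct, add_mul, Finset.sum_add_distrib]

lemma lin_smul (a : R) (x : Coord n → R) (t : Fin n → R) : lin (a • x) t = a * lin x t := by
  simp [lin, dotProduct, Finset.mul_sum, mul_assoc]

lemma quad_eq_sum (x : Coord n → R) (t : Fin n → R) :
    quad x t = ∑ a, ∑ b, x (.inr s(a, b)) * (t a * t b) := by
  simp only [quad, dotProduct, Matrix.mulVec, Finset.mul_sum, symMat, Matrix.of_apply]
  exact Finset.sum_congr rfl fun a _ => Finset.sum_congr rfl fun b _ => by ring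

lemma quad_add (x y : Coord n → R) (t : Fin n → R) : quad (x + y) t = quad x t + quad y t := by
  simp [quad_eq_sum, add_mul, Finset.sum_add_distrib]

lemma quad_smul (a : R) (x : Coord n → R) (t : Fin n → R) :
    quad (a • x) t = a * quad x t := by
  simp [quad_eq_sum, Finset.mul_sum, mul_assoc]

lemma lin_arg_smul (x : Coord n → R) (a : R) (t : Fin n → R) :
    lin x (a • t) = a * lin x t := by
  simp [lin]

lemma quad_arg_smul (x : Coord n → R) (a : R) (t : Fin n → R) :
    quad x (a • t) = a ^ 2 * quad x t := by
  simp [quad, Matrix.mulVec_smul]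
  ring

/-- The action of a matrix on parameters, by substitution in the linear and quadratic forms. -/
noncomputable def moveParam (B : Matrix (Fin n) (Fin n) R) (x : Coord n → R) : Coord n → R
  | .inl a => Matrix.vecMul (fun a => x (.inl a)) B a
  | .inr e => symEntry (B.transpose * symMat x * B) e

lemma lin_moveParam (B : Matrix (Fin n) (Fin n) R) (x : Coord n → R) (t : Fin n → R) :
    lin (moveParam B x) t = lin x (B.mulVec t) := by
  rw [lin, lin, Matrix.dotProduct_mulVec]
  rfl

lemma symMat_moveParam (B : Matrix (Fin n) (Fin n) R) (x : Coord n → R) :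
    symMat (moveParam B x) = B.transpose * symMat x * B := by
  ext a b
  refine (symEntry_mk (S := B.transpose * symMat x * B) ?_ a b :)
  rw [Matrix.IsSymm, Matrix.transpose_mul, Matrix.transpose_mul, Matrix.transpose_transpose,
    (symMat_isSymm x).eq, Matrix.mul_assoc]

lemma quad_moveParam (B : Matrix (Fin n) (Fin n) R) (x : Coord n → R) (t : Fin n → R) :
    quad (moveParam B x) t = quad x (B.mulVec t) := by
  rw [quad, quad, symMat_moveParam, ← Matrix.mulVec_mulVec, ← Matrix.mulVec_mulVec,
    Matrix.mulVec_transpose, dotProduct_comm, ← Matrix.dotProduct_mulVec, dotProduct_comm]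

lemma moveParam_one (x : Coord n → R) : moveParam (1 : Matrix (Fin n) (Fin n) R) x = x := by
  ext (a | e)
  · simp [moveParam]
  · induction e with | _ a b => ?_
    have := symEntry_mk (symMat_isSymm x) a b
    simpa [moveParam, symMat] using this

/-- The moment form of degree 5, with leading constant `c`, as a function. -/
def form (c : R) (x : Coord n → R) (t : Fin n → R) : R :=
  lin x t ^ 5 + 10 * quad x t * lin x t ^ 3 + c * quad x t ^ 2 * lin x t

/-- The derivative of `form` with respect to the parameter. -/
def formDeriv (c : R) (x v : Coord n → R) (t : Fin n → R) : R :=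
  quad v t * (10 * lin x t ^ 3 + 2 * c * quad x t * lin x t) +
    lin v t * (5 * lin x t ^ 4 + 30 * quad x t * lin x t ^ 2 + c * quad x t ^ 2)

end Forms

/-! ### Irreducibility of the space of forms -/

section Strict

variable {τ : Type*} {n : ℕ}

/-- The derivatives of the moment forms, as linear maps. -/
def tangentMap (C : τ → ℂ) (c : τ) (x : Coord n → ℂ) :
    (Coord n → ℂ) →ₗ[ℂ] (Fin n → ℂ) → ℂ where
  toFun v := formDeriv (C c) x v
  map_add' v w := by
    ext t
    simp only [formDeriv, lin_add, quad_add, Pi.add_apply]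
    ring
  map_smul' a v := by
    ext t
    simp only [formDeriv, lin_smul, quad_smul, Pi.smul_apply, RingHom.id_apply, smul_eq_mul]
    ring

lemma tangentMap_apply (C : τ → ℂ) (c : τ) (x v : Coord n → ℂ) (t : Fin n → ℂ) :
    tangentMap C c x v t = formDeriv (C c) x v t := rfl

lemma isPolyFun_lin {γ : ℂ → Coord n → ℂ} (hγ : ∀ j, IsPolyFun fun z => γ z j)
    {t : ℂ → Fin n → ℂ} (ht : ∀ j, IsPolyFun fun z => t z j) :
    IsPolyFun fun z => lin (γ z) (t z) :=
  IsPolyFun.sum (f := fun a z => γ z (.inl a) * t z a) Finset.univ fun a => (hγ _).mul (ht a)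

lemma isPolyFun_mulVec {B : ℂ → Matrix (Fin n) (Fin n) ℂ}
    (hB : ∀ i j, IsPolyFun fun z => B z i j) (t : Fin n → ℂ) (i : Fin n) :
    IsPolyFun fun z => (B z).mulVec t i :=
  IsPolyFun.sum (f := fun j z => B z i j * t j) Finset.univ fun j =>
    (hB i j).mul (IsPolyFun.const _)

lemma isPolyFun_quad {γ : ℂ → Coord n → ℂ} (hγ : ∀ j, IsPolyFun fun z => γ z j)
    {t : ℂ → Fin n → ℂ} (ht : ∀ j, IsPolyFun fun z => t z j) :
    IsPolyFun fun z => quad (γ z) (t z) := by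
  simp_rw [quad_eq_sum]
  exact IsPolyFun.sum _ fun a => IsPolyFun.sum _ fun b => (hγ _).mul ((ht a).mul (ht b))

lemma isPolyFun_formDeriv (c : ℂ) {γ : ℂ → Coord n → ℂ} (hγ : ∀ j, IsPolyFun fun z => γ z j)
    (v : Coord n → ℂ) {t : ℂ → Fin n → ℂ} (ht : ∀ j, IsPolyFun fun z => t z j) :
    IsPolyFun fun z => formDeriv c (γ z) v (t z) := by
  have h1 := isPolyFun_lin hγ ht
  have h2 := isPolyFun_quad hγ ht
  have h3 := isPolyFun_lin (fun j => IsPolyFun.const (v j)) ht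
  have h4 := isPolyFun_quad (fun j => IsPolyFun.const (v j)) ht
  have k := fun a : ℂ => IsPolyFun.const a
  exact (h4.mul (((k 10).mul (h1.pow 3)).add (((k (2 * c)).mul h2).mul h1))).add
    (h3.mul ((((k 5).mul (h1.pow 4)).add (((k 30).mul h2).mul (h1.pow 2))).add
      ((k c).mul (h2.pow 2))))

lemma isPolyFamily_tangentMap (C : τ → ℂ) : IsPolyFamily (tangentMap (n := n) C) :=
  fun c _ hγ v _ => isPolyFun_formDeriv (C c) hγ v fun _ => IsPolyFun.const _

lemma formDeriv_arg_smul (c : ℂ) (x v : Coord n → ℂ) (a : ℂ) (t : Fin n → ℂ) :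
    formDeriv c x v (a • t) = a ^ 5 * formDeriv c x v t := by
  simp only [formDeriv, lin_arg_smul, quad_arg_smul]
  ring

lemma tangentMap_moveParam (C : τ → ℂ) (c : τ) (B : Matrix (Fin n) (Fin n) ℂ)
    (x v : Coord n → ℂ) :
    tangentMap C c (moveParam B x) (moveParam B v) = tangentMap C c x v ∘ B.mulVec := by
  ext t
  simp only [tangentMap_apply, formDeriv, lin_moveParam, quad_moveParam, Function.comp]

lemma isPolyFun_moveParam {B : ℂ → Matrix (Fin n) (Fin n) ℂ}
    (hB : ∀ i j, IsPolyFun fun z => B z i j) (x : Coord n → ℂ) (j : Coord n) :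
    IsPolyFun fun z => moveParam (B z) x j := by
  rcases j with a | e
  · exact IsPolyFun.sum (f := fun b z => x (.inl b) * B z b a) Finset.univ fun b =>
      (IsPolyFun.const _).mul (hB _ _)
  · exact IsPolyFun.sum
      (f := fun b z => (∑ d, B z d e.out.1 * symMat x d b) * B z b e.out.2) Finset.univ
      fun b => (IsPolyFun.sum _ fun d => (hB _ _).mul (IsPolyFun.const _)).mul (hB _ _)

/-- The space of quintics is irreducible under substitutions: a nonzero `v` in a constant
intersection degenerates to all fifth powers of linear forms, which span. The hypothesis `hlt` says
that the intersection is nonzero. -/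
lemma choose_le_genRank_of_const [DecidableEq τ] (C : τ → ℂ) {S : Finset (τ × ℕ)} {p : τ × ℕ}
    {e : τ × ℕ → τ × ℕ} (he : ∀ s, (e s).1 = s.1) (hinj : Function.Injective e)
    (hdisj : ∀ s ∈ S, e s ∉ S) (hp : ∀ s ∈ S, p ≠ s ∧ p ≠ e s)
    (hconst : ∀ s ∈ S, genRank (tangentMap (n := n) C) (insert p (insert (e s) S)) +
        genRank (tangentMap (n := n) C) S =
      genRank (tangentMap (n := n) C) (insert p S) +
        genRank (tangentMap (n := n) C) (insert (e s) S))
    (hlt : genRank (tangentMap (n := n) C) (insert p S) <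
      genRank (tangentMap (n := n) C) {p} + genRank (tangentMap (n := n) C) S) :
    (n + 4).choose 5 ≤ genRank (tangentMap (n := n) C) S := by
  have hT := isPolyFamily_tangentMap (n := n) C
  obtain ⟨x, hx⟩ := exists_isGood hT (insert p (S ∪ S.image e))
  have hdim := hx.finrank_inf_add (S := S) (p := p)
    (Finset.insert_subset_insert p Finset.subset_union_left)
  obtain ⟨v, hv, hv0⟩ := Submodule.exists_mem_ne_zero_of_ne_bot
    (p := LinearMap.range (tangentMap C p.1 (x p)) ⊓ tangentSum (tangentMap C) S x) (by
      intro h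
      rw [h, finrank_bot] at hdim
      omega)
  obtain ⟨y, hy⟩ := Function.ne_iff.1 hv0
  have hpow : ∀ q : Fin n → ℂ,
      (fun t => (q ⬝ᵥ t) ^ 5) ∈ tangentSum (tangentMap C) (S.image e) x := by
    intro q
    -- The line from the identity at `z = 0` to the rank-one matrix `y qᵀ` at `z = 1`. Substituting
    -- the latter turns a quintic `u` into `u(y) (q ⬝ᵥ t) ^ 5`, and `y` was chosen with `v y ≠ 0`.
    let B : ℂ → Matrix (Fin n) (Fin n) ℂ := fun z =>
      1 + z • (Matrix.vecMulVec y q - 1)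
    have hB : ∀ i j, IsPolyFun fun z => B z i j := fun i j =>
      (IsPolyFun.const _).add (IsPolyFun.id.mul (IsPolyFun.const _))
    have hB1 : ∀ t, (B 1).mulVec t = (q ⬝ᵥ t) • y := by
      intro t
      ext i
      simp [B, Matrix.vecMulVec_mulVec, mul_comm]
    have hmem := hx.comp_mem_tangentSum_image hT he hinj hdisj hp hconst
      (A := fun z => (B z).mulVec) (Φ := fun z => moveParam (B z))
      (fun x => by simp [B, moveParam_one])
      (fun x j => isPolyFun_moveParam hB x j)
      (fun c x v t => isPolyFun_formDeriv (C c) (γ := fun _ => x) (fun _ => IsPolyFun.const _) v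
        (isPolyFun_mulVec hB t))
      (fun z c x v => tangentMap_moveParam C c (B z) x v) hv 1
    obtain ⟨v₀, rfl⟩ := hv.1
    have heq : tangentMap C p.1 (x p) v₀ ∘ (B 1).mulVec =
        tangentMap C p.1 (x p) v₀ y • fun t => (q ⬝ᵥ t) ^ 5 := by
      ext t
      rw [Function.comp, hB1, tangentMap_apply, formDeriv_arg_smul, Pi.smul_apply, smul_eq_mul,
        tangentMap_apply, mul_comm]
    rw [heq] at hmem
    exact (Submodule.smul_mem_iff _ hy).1 hmem
  refine (choose_le_finrank_of_powers_mem hpow).trans ?_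
  refine (finrank_le_genRank _ x).trans (le_of_eq (genRank_congr ?_))
  rw [Finset.image_val_of_injOn hinj.injOn, Multiset.map_map]
  exact Multiset.map_congr rfl fun s _ => he s

end Strict

/-! ### Injectivity of the derivatives -/

section Nondegenerate

variable {n : ℕ}

lemma lin_single (x : Coord n → ℂ) (a : Fin n) (z : ℂ) :
    lin x (Pi.single a z) = x (.inl a) * z := by
  simp [lin]

lemma lin_arg_add (x : Coord n → ℂ) (t u : Fin n → ℂ) : lin x (t + u) = lin x t + lin x u := by
  simp [lin]

lemma quad_single (x : Coord n → ℂ) (a : Fin n) (z : ℂ) :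
    quad x (Pi.single a z) = x (.inr s(a, a)) * z ^ 2 := by
  simp [quad, symMat]
  ring

lemma quad_single_add_single (x : Coord n → ℂ) (a b : Fin n) :
    quad x (Pi.single a 1 + Pi.single b 1) =
      x (.inr s(a, a)) + x (.inr s(b, b)) + 2 * x (.inr s(a, b)) := by
  simp [quad, symMat, Matrix.mulVec_add, Sym2.eq_swap (a := b) (b := a)]
  ring

/-- Polarization on the coordinate vectors. -/
lemma eq_zero_of_quad_eq_zero {x : Coord n → ℂ} (h : ∀ t, quad x t = 0) (e : Sym2 (Fin n)) :
    x (.inr e) = 0 := by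
  induction e with | _ a b => ?_
  have h1 := h (Pi.single a 1)
  have h2 := h (Pi.single b 1)
  have h3 := h (Pi.single a 1 + Pi.single b 1)
  rw [quad_single] at h1 h2
  rw [quad_single_add_single] at h3
  linear_combination (h3 - h1 - h2) / 2

/-- The derivative of the moment form is injective at the point with forms `t₁` and `t₂²`. -/
lemma exists_formDeriv_injective (hn : 2 ≤ n) {c : ℂ} (hc0 : c ≠ 0) (hc : c ≠ 25) :
    ∃ x : Coord n → ℂ, ∀ v, formDeriv c x v = 0 → v = 0 := by
  let i : Fin n := ⟨0, by omega⟩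
  let j : Fin n := ⟨1, by omega⟩
  have hij : i ≠ j := by simp [i, j]
  let x : Coord n → ℂ := Pi.single (.inl i) 1 + Pi.single (.inr s(j, j)) 1
  have hlin : ∀ t, lin x t = t i := by
    intro t
    simp [x, lin, dotProduct, Pi.single_apply]
  have hquad : ∀ t, quad x t = t j ^ 2 := by
    intro t
    rw [quad_eq_sum, Finset.sum_eq_single j, Finset.sum_eq_single j]
    · simp [x]; ring
    · intro b _ hb
      simp [x, hb]
    · simp
    · intro a _ ha
      refine Finset.sum_eq_zero fun b _ => ?_
      simp [x, ha]
    · simp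
  refine ⟨x, fun v hv => ?_⟩
  have H : ∀ t, quad v t * (10 * t i ^ 3 + 2 * c * t j ^ 2 * t i) +
      lin v t * (5 * t i ^ 4 + 30 * t j ^ 2 * t i ^ 2 + c * (t j ^ 2) ^ 2) = 0 := by
    intro t
    have := congrFun hv t
    rwa [formDeriv, hlin, hquad] at this
  -- On the hyperplane `t i = 0` only `c * lin v t * t j ^ 4` survives, which forces `lin v` to be a
  -- multiple of `t i`.
  have hvj : v (.inl j) = 0 := by
    have := H (Pi.single j 1)
    simpa [lin_single, hij, hc0] using this
  have hva : ∀ a, a ≠ i → v (.inl a) = 0 := by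
    intro a ha
    by_cases haj : a = j
    · rw [haj, hvj]
    · have := H (Pi.single a 1 + Pi.single j 1)
      simpa [lin_single, lin_arg_add, hij, hc0, hvj, Ne.symm ha, haj, Ne.symm haj] using this
  have hlinv : ∀ t, lin v t = v (.inl i) * t i := by
    intro t
    rw [lin, dotProduct, Finset.sum_eq_single i]
    · intro a _ ha
      rw [hva a ha, zero_mul]
    · simp
  have hvi : v (.inl i) = 0 := by
    -- At `t i = z`, `t j = 1` with `z² = -c/5` the coefficient of `quad v` vanishes, and that of
    -- `lin v` equals `c (c - 25) / 5`; hence the exclusion of `c = 25`.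
    obtain ⟨z, hz⟩ := IsAlgClosed.exists_pow_nat_eq (-c / 5) (n := 2) (by norm_num)
    have hz0 : z ≠ 0 := by
      rintro rfl
      apply hc0
      linear_combination 5 * hz
    have := H (Pi.single i z + Pi.single j 1)
    rw [hlinv] at this
    simp only [Pi.add_apply, Pi.single_eq_same, Pi.single_eq_of_ne hij, add_zero,
      Pi.single_eq_of_ne hij.symm, zero_add] at this
    have h2 : v (.inl i) * (z * (c * (c - 25))) = 0 := by
      have e1 : 10 * z ^ 3 + 2 * c * 1 ^ 2 * z = 0 := by linear_combination 10 * z * hz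
      rw [e1, mul_zero, zero_add] at this
      linear_combination 5 * this - v (.inl i) * z * (25 * z ^ 2 - 5 * c + 150) * hz
    simpa [hz0, hc0, sub_eq_zero, hc] using h2
  -- What remains is `quad v` times a nonzero cubic. On each line in direction `i` the cubic has
  -- finitely many zeros, so `quad v` vanishes on the whole line.
  have hq : ∀ t, quad v t = 0 := by
    intro t
    have ht : ∀ k, IsPolyFun fun z : ℂ => (t + Pi.single i z : Fin n → ℂ) k := by
      intro k
      by_cases hk : k = i
      · subst hk
        simpa using (IsPolyFun.const (t i)).add IsPolyFun.id
      · simpa [hk] using IsPolyFun.const (t k)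
    have hf : IsPolyFun fun z : ℂ => (t i + z) * (5 * (t i + z) ^ 2 + c * t j ^ 2) :=
      ((IsPolyFun.const _).add IsPolyFun.id).mul
        (((IsPolyFun.const 5).mul (((IsPolyFun.const _).add IsPolyFun.id).pow 2)).add
          (IsPolyFun.const _))
    obtain ⟨z₀, hz₀⟩ : ∃ z : ℂ, (t i + z) * (5 * (t i + z) ^ 2 + c * t j ^ 2) ≠ 0 := by
      by_contra! h
      have h1 := h (1 - t i)
      have h2 := h (2 - t i)
      norm_num at h1 h2
      have h3 : (15 : ℂ) = 0 := by linear_combination h2 - h1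
      norm_num at h3
    have hfin := hf.finite_zeros hz₀
    have hg := isPolyFun_quad (fun k => IsPolyFun.const (v k)) ht
    have hzero : ∀ z : ℂ, (t i + z) * (5 * (t i + z) ^ 2 + c * t j ^ 2) ≠ 0 →
        quad v (t + Pi.single i z) = 0 := by
      intro z hz
      have := H (t + Pi.single i z)
      rw [hlinv, hvi] at this
      simp only [Pi.add_apply, Pi.single_eq_same, Pi.single_eq_of_ne hij.symm, add_zero,
        zero_mul] at this
      refine (mul_eq_zero.1 this).resolve_right fun h => hz ?_
      linear_combination h / 2
    by_contra hne
    have hfin2 := hg.finite_zeros (z₀ := 0) (by simpa using hne)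
    obtain ⟨z, hz⟩ := (hfin.union hfin2).exists_notMem
    rw [Set.mem_union, not_or] at hz
    exact hz.2 (hzero z hz.1)
  ext (a | e)
  · by_cases ha : a = i
    · rw [ha, hvi]; rfl
    · rw [hva a ha]; rfl
  · exact eq_zero_of_quad_eq_zero hq e

/-- The constants of the moment forms of Gaussians (`false`) and Laplace distributions (`true`). -/
def formConst (b : Bool) : ℂ := if b then 30 else 15

lemma genRank_singleton (hn : 2 ≤ n) (p : Bool × ℕ) :
    genRank (tangentMap (n := n) formConst) {p} = Fintype.card (Coord n) := by
  obtain ⟨x, hx⟩ := exists_formDeriv_injective hn (c := formConst p.1)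
    (by unfold formConst; split_ifs <;> norm_num) (by unfold formConst; split_ifs <;> norm_num)
  have hle := genRank_le_card_mul (T := tangentMap (n := n) formConst) {p}
  rw [Finset.card_singleton, one_mul] at hle
  refine le_antisymm hle ?_
  refine le_trans (le_of_eq ?_) (finrank_le_genRank {p} fun _ => x)
  rw [tangentSum_singleton, LinearMap.finrank_range_of_inj, Module.finrank_fintype_fun_eq_card]
  rw [← LinearMap.ker_eq_bot, LinearMap.ker_eq_bot']
  exact hx

/-- The generic rank for points of prescribed types. -/
noncomputable def typeRank (n : ℕ) (m : Multiset Bool) : ℕ :=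
  genRank (tangentMap (n := n) formConst) m.toEnumFinset

lemma genRank_eq_typeRank {S : Finset (Bool × ℕ)} {m : Multiset Bool}
    (h : S.val.map Prod.fst = m) :
    genRank (tangentMap (n := n) formConst) S = typeRank n m :=
  genRank_congr (by rw [h, Multiset.map_toEnumFinset_fst])

lemma genRank_insert_eq_typeRank {S : Finset (Bool × ℕ)} {m : Multiset Bool} {p : Bool × ℕ}
    (h : S.val.map Prod.fst = m) (hp : p ∉ S) :
    genRank (tangentMap (n := n) formConst) (insert p S) = typeRank n (p.1 ::ₘ m) :=
  genRank_eq_typeRank (by rw [Finset.insert_val_of_notMem hp, Multiset.map_cons, h])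

/-- Hence labels from `Multiset.card m` on are free for new points. -/
lemma lt_card_of_mem_toEnumFinset {m : Multiset Bool} {p : Bool × ℕ}
    (h : p ∈ m.toEnumFinset) : p.2 < Multiset.card m :=
  ((Multiset.mem_toEnumFinset m p).1 h).trans_le (Multiset.count_le_card _ _)

/-- The counting argument applies because there are only two types; its strictness hypothesis is the
contrapositive of `choose_le_genRank_of_const`. -/
lemma typeRank_eq (hn : 2 ≤ n) (m : Multiset Bool)
    (hN : Multiset.card m * Fintype.card (Coord n) +
      Fintype.card (Coord n) * Fintype.card (Coord n) ≤ (n + 4).choose 5) :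
    typeRank n m = Multiset.card m * Fintype.card (Coord n) := by
  have hT := isPolyFamily_tangentMap (n := n) formConst
  have hnew : ∀ (b : Bool) (m : Multiset Bool) (k : ℕ),
      (b, Multiset.card m + k) ∉ m.toEnumFinset := by
    intro b m k h
    have := lt_card_of_mem_toEnumFinset h
    simp at this
  have h1 : ∀ b m, genRank (tangentMap (n := n) formConst)
      (insert (b, Multiset.card m) m.toEnumFinset) = typeRank n (b ::ₘ m) := fun b m =>
    genRank_insert_eq_typeRank (Multiset.map_toEnumFinset_fst m) (by simpa using hnew b m 0)
  have hsub : ∀ b b' m, typeRank n (b ::ₘ b' ::ₘ m) + typeRank n m ≤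
      typeRank n (b ::ₘ m) + typeRank n (b' ::ₘ m) := by
    intro b b' m
    have hS := genRank_submodular hT (b, Multiset.card m) (b', Multiset.card m + 1)
      m.toEnumFinset
    have h2 : (insert (b', Multiset.card m + 1) m.toEnumFinset).val.map Prod.fst = b' ::ₘ m := by
      rw [Finset.insert_val_of_notMem (hnew _ _ _), Multiset.map_cons,
        Multiset.map_toEnumFinset_fst]
    rw [h1, genRank_eq_typeRank h2, genRank_insert_eq_typeRank h2] at hS
    · exact hS
    · simpa using hnew b m 0
  refine eq_card_mul_of_strict (f := typeRank n) ?_ ?_ ?_ hsub ?_ m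
    (Finset.card_le_univ _) hN
  · have := genRank_le_card_mul (T := tangentMap (n := n) formConst)
      (Multiset.toEnumFinset (0 : Multiset Bool))
    simpa [typeRank] using this
  · intro b m
    rw [← h1]
    exact genRank_mono hT (Finset.subset_insert _ _)
  · intro b m
    rw [← h1]
    exact genRank_insert_le _ _
  · intro b m hlt hbm
    by_contra! hne
    refine absurd hlt (not_lt.2 ?_)
    have h2 : ∀ b', ∀ k, (insert (b', Multiset.card m + k) m.toEnumFinset).val.map Prod.fst =
        b' ::ₘ m := by
      intro b' k
      rw [Finset.insert_val_of_notMem (hnew _ _ _), Multiset.map_cons,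
        Multiset.map_toEnumFinset_fst]
    -- The label `Multiset.card m` goes to `p`, and the fresh copies start one above it, so they
    -- avoid both `p` and the old points.
    refine choose_le_genRank_of_const formConst (p := (b, Multiset.card m))
      (e := fun s => (s.1, Multiset.card m + (s.2 + 1))) (fun _ => rfl) ?_ ?_ ?_ ?_ ?_
    · rintro ⟨b, k⟩ ⟨b', k'⟩ h
      simpa using h
    · exact fun s _ => hnew _ _ _
    · rintro s hs
      have := lt_card_of_mem_toEnumFinset hs
      constructor <;> rintro h <;> have := congrArg Prod.snd h <;> simp at this
      omega
    · intro s hs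
      have hsm : s.1 ∈ m := Multiset.mem_of_mem_toEnumFinset hs
      rw [h1, genRank_eq_typeRank (h2 _ _), genRank_insert_eq_typeRank (h2 _ _)]
      · exact le_antisymm (hsub _ _ _) (hne _ hsm)
      · simpa using hnew b m 0
    · rw [h1, genRank_singleton hn, add_comm]
      exact hbm

/-- At suitable points, the sum of the tangent spaces is direct. -/
theorem exists_formDeriv_sum_injective {r s : ℕ} (hn : 2 ≤ n)
    (hN : (r + s) * Fintype.card (Coord n) +
      Fintype.card (Coord n) * Fintype.card (Coord n) ≤ (n + 4).choose 5) :
    ∃ x : Fin r ⊕ Fin s → Coord n → ℂ, ∀ v : Fin r ⊕ Fin s → Coord n → ℂ,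
      (∀ t, ∑ i, formDeriv (formConst i.isRight) (x i) (v i) t = 0) → v = 0 := by
  classical
  let idx : Fin r ⊕ Fin s ↪ Bool × ℕ :=
    ⟨fun i => (i.isRight, Sum.elim (fun i => i.1) (fun j => j.1) i), by
      rintro (i | i) (j | j) h <;> simp_all [Fin.ext_iff]⟩
  let S : Finset (Bool × ℕ) := Finset.univ.map idx
  have hcard : Multiset.card (S.val.map Prod.fst) = r + s := by simp [S]
  have hrank := typeRank_eq hn (S.val.map Prod.fst) (by rwa [hcard])
  obtain ⟨x, hx⟩ := exists_finrank_eq_genRank (tangentMap (n := n) formConst) S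
  rw [genRank_eq_typeRank rfl, hrank, hcard] at hx
  let L : (Fin r ⊕ Fin s → Coord n → ℂ) →ₗ[ℂ] (Fin n → ℂ) → ℂ :=
    ∑ i, tangentMap formConst i.isRight (x (idx i)) ∘ₗ LinearMap.proj i
  have hL : ∀ v t, L v t = ∑ i, formDeriv (formConst i.isRight) (x (idx i)) (v i) t := by
    intro v t
    simp [L, LinearMap.sum_apply, Finset.sum_apply, tangentMap_apply]
  have hle : tangentSum (tangentMap formConst) S x ≤ LinearMap.range L := by
    refine iSup₂_le fun s hs => ?_
    obtain ⟨i, -, rfl⟩ := Finset.mem_map.1 hs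
    rintro _ ⟨v, rfl⟩
    refine ⟨Pi.single i v, ?_⟩
    simp only [L, LinearMap.sum_apply, LinearMap.comp_apply, LinearMap.proj_apply]
    rw [Finset.sum_eq_single i]
    · rw [Pi.single_eq_same]
      rfl
    · intro k _ hk
      simp [hk]
    · simp
  have h1 := Submodule.finrank_mono hle
  have h2 := LinearMap.finrank_range_add_finrank_ker L
  rw [Module.finrank_pi_fintype] at h2
  simp only [Module.finrank_fintype_fun_eq_card, Finset.sum_const, Finset.card_univ,
    Fintype.card_sum, Fintype.card_fin, smul_eq_mul] at h2
  simp only [Fintype.card_sum, Fintype.card_fin] at hx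
  -- The range of `L` has the full dimension `(r + s) * D` of the source.
  have hker : LinearMap.ker L = ⊥ := Submodule.finrank_eq_zero.1 (by omega)
  refine ⟨fun i => x (idx i), fun v hv => ?_⟩
  exact LinearMap.ker_eq_bot'.1 hker v (funext fun t => (hL v t).trans (hv t))

end Nondegenerate

/-! ### Finiteness of general fibres from the Jacobian criterion -/

section Jacobian

variable {σ X K : Type} [Fintype σ] [Field K]

lemma derivation_algebraMap_eq_sum_pderiv {L Q M : Type*} [Field L] [Field Q] [Algebra K L]
    [Algebra L Q] [Algebra K Q] [IsScalarTower K L Q] [Algebra (MvPolynomial σ K) Q]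
    [IsScalarTower K (MvPolynomial σ K) Q] [AddCommGroup M] [Module Q M] [Module L M]
    (D : Derivation L Q M) (a : MvPolynomial σ K) :
    D (algebraMap _ Q a) = ∑ k, algebraMap (MvPolynomial σ K) Q (MvPolynomial.pderiv k a) •
      D (algebraMap (MvPolynomial σ K) Q (MvPolynomial.X k)) := by
  classical
  induction a using MvPolynomial.induction_on with
  | C c =>
    rw [← MvPolynomial.algebraMap_eq, ← IsScalarTower.algebraMap_apply,
      IsScalarTower.algebraMap_apply K L Q, Derivation.map_algebraMap]
    simp
  | add p q hp hq => simp [hp, hq, add_smul, Finset.sum_add_distrib]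
  | mul_X p i hp =>
    simp only [Derivation.leibniz, hp, MvPolynomial.pderiv_X, add_smul, smul_eq_mul, map_add,
      map_mul, Finset.sum_add_distrib, Finset.smul_sum, smul_smul]
    congr 1
    rw [Finset.sum_eq_single i]
    · simp
    · intro k _ hk
      simp [hk]
    · simp

/-- In `Ω[Q⁄L]` the differentials of the `m i` vanish. Since the Jacobian matrix is invertible over
`Q`, so do those of the variables, and `Ω[Q⁄L] = 0`. As `Q` is essentially of finite type over `L`,
it is separable algebraic. -/
lemma isAlgebraic_X_of_det_ne_zero [CharZero K] {L Q : Type} [Field L] [Field Q] [Algebra K L]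
    [Algebra L Q] [Algebra K Q] [IsScalarTower K L Q] [Algebra (MvPolynomial σ K) Q]
    [IsScalarTower K (MvPolynomial σ K) Q] [IsFractionRing (MvPolynomial σ K) Q]
    [DecidableEq σ] {m : σ → MvPolynomial σ K}
    (hm : ∀ i, algebraMap _ Q (m i) ∈ Set.range (algebraMap L Q))
    (hJ : (Matrix.of fun i k => MvPolynomial.pderiv k (m i)).det ≠ 0) (k : σ) :
    IsAlgebraic L (algebraMap (MvPolynomial σ K) Q (MvPolynomial.X k)) := by
  have : Algebra.EssFiniteType (MvPolynomial σ K) Q :=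
    Algebra.EssFiniteType.of_isLocalization Q (nonZeroDivisors (MvPolynomial σ K))
  have : Algebra.EssFiniteType K Q := Algebra.EssFiniteType.comp K (MvPolynomial σ K) Q
  have : Algebra.EssFiniteType L Q := Algebra.EssFiniteType.of_comp K L Q
  have hinj := IsFractionRing.injective (MvPolynomial σ K) Q
  let D := KaehlerDifferential.D L Q
  let J : Matrix σ σ Q :=
    (algebraMap (MvPolynomial σ K) Q).mapMatrix
      (Matrix.of fun i k => MvPolynomial.pderiv k (m i))
  have hJQ : J.det ≠ 0 := by
    rw [← RingHom.map_det]
    simpa using hinj.ne hJ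
  have hDX : ∀ k, D (algebraMap (MvPolynomial σ K) Q (MvPolynomial.X k)) = 0 := by
    intro k
    have h1 : ∀ i, ∑ j, J i j • D (algebraMap (MvPolynomial σ K) Q (MvPolynomial.X j)) = 0 := by
      intro i
      obtain ⟨l, hl⟩ := hm i
      refine (derivation_algebraMap_eq_sum_pderiv D (m i)).symm.trans ?_
      rw [← hl, Derivation.map_algebraMap]
    have h2 : J.det • D (algebraMap (MvPolynomial σ K) Q (MvPolynomial.X k)) = 0 := by
      have h3 : ∑ i, J.adjugate k i • ∑ j, J i j • D (algebraMap (MvPolynomial σ K) Q (MvPolynomial.X j)) = 0 := by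
        simp [h1]
      simp_rw [Finset.smul_sum, smul_smul] at h3
      rw [Finset.sum_comm] at h3
      simp_rw [← Finset.sum_smul, ← Matrix.mul_apply, Matrix.adjugate_mul, Matrix.smul_apply,
        Matrix.one_apply] at h3
      simpa using h3
    exact (smul_eq_zero.1 h2).resolve_left hJQ
  have hDA : ∀ a : MvPolynomial σ K, D (algebraMap _ Q a) = 0 := by
    intro a
    rw [derivation_algebraMap_eq_sum_pderiv]
    simp [hDX]
  have hDQ : ∀ q : Q, D q = 0 := by
    intro q
    obtain ⟨a, b, hb, rfl⟩ := IsFractionRing.div_surjective (A := MvPolynomial σ K) q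
    have hb0 : algebraMap _ Q b ≠ 0 := by
      simpa using hinj.ne (nonZeroDivisors.ne_zero hb)
    have h1 := D.leibniz (algebraMap _ Q b) (algebraMap _ Q a / algebraMap _ Q b)
    rw [mul_div_cancel₀ _ hb0, hDA, hDA, smul_zero, add_zero] at h1
    exact (smul_eq_zero.1 h1.symm).resolve_left hb0
  have hsub : Subsingleton (Ω[Q⁄L]) := by
    rw [← Submodule.subsingleton_iff Q]
    refine subsingleton_of_bot_eq_top ?_
    rw [← KaehlerDifferential.span_range_derivation, eq_comm, Submodule.span_eq_bot]
    rintro _ ⟨q, rfl⟩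
    exact hDQ q
  have : Algebra.FormallyUnramified L Q := ⟨hsub⟩
  have : Algebra.IsSeparable L Q := Algebra.FormallyUnramified.isSeparable L Q
  exact (Algebra.IsSeparable.isIntegral L _).isAlgebraic

variable [CharZero K]

lemma isAlgebraic_X_of_isFractionRing {B : Subalgebra K (MvPolynomial σ K)} {L Q : Type}
    [Field L] [Field Q] [Algebra K L]
    [Algebra L Q] [Algebra K Q] [IsScalarTower K L Q] [Algebra (MvPolynomial σ K) Q]
    [IsScalarTower K (MvPolynomial σ K) Q] [IsFractionRing (MvPolynomial σ K) Q]
    [Algebra B L] [IsFractionRing B L] [IsScalarTower B L Q]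
    [DecidableEq σ] {m : σ → MvPolynomial σ K} (hm : ∀ i, m i ∈ B)
    (hJ : (Matrix.of fun i k => MvPolynomial.pderiv k (m i)).det ≠ 0) (k : σ) :
    IsAlgebraic B (MvPolynomial.X k : MvPolynomial σ K) := by
  have halg := isAlgebraic_X_of_det_ne_zero (L := L) (Q := Q) (m := m) (fun i =>
    ⟨algebraMap B L ⟨m i, hm i⟩, (IsScalarTower.algebraMap_apply B L Q _).symm⟩) hJ k
  exact (isAlgebraic_algebraMap_iff (IsFractionRing.injective (MvPolynomial σ K) Q)).1
    ((IsFractionRing.isAlgebraic_iff B L Q).2 halg)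

/-- If the Jacobian matrix of a family of polynomials has full rank at some point, then every
variable is algebraic over the subalgebra generated by the family. -/
lemma isAlgebraic_X_of_jacobian {m : X → MvPolynomial σ K} {x : σ → K}
    (hx : ∀ v : σ → K, (∀ t, ∑ k, MvPolynomial.eval x (MvPolynomial.pderiv k (m t)) * v k = 0) →
      v = 0) (k : σ) :
    IsAlgebraic (Algebra.adjoin K (Set.range m)) (MvPolynomial.X k : MvPolynomial σ K) := by
  classical
  have hli : LinearIndependent K fun (k : σ) (t : X) =>
      MvPolynomial.eval x (MvPolynomial.pderiv k (m t)) := by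
    rw [Fintype.linearIndependent_iff]
    intro c hc
    refine congrFun (hx c fun t => ?_)
    simpa [mul_comm] using congrFun hc t
  obtain ⟨t, ht⟩ := exists_det_eval_ne_zero hli
  have hJ : (Matrix.of fun i k => MvPolynomial.pderiv k (m (t i))).det ≠ 0 := by
    intro h
    apply ht
    have := congrArg (MvPolynomial.eval x) h
    rw [RingHom.map_det, map_zero] at this
    exact this
  -- Only the fraction field property of `Q` and `L` is kept, so the algebra structures set up below
  -- are the only other ones on them.
  obtain ⟨Q, _, _, _⟩ : ∃ (Q : Type) (_ : Field Q) (_ : Algebra (MvPolynomial σ K) Q),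
      IsFractionRing (MvPolynomial σ K) Q :=
    ⟨FractionRing (MvPolynomial σ K), inferInstance, inferInstance, inferInstance⟩
  obtain ⟨L, _, _, _⟩ : ∃ (L : Type) (_ : Field L)
      (_ : Algebra (Algebra.adjoin K (Set.range m)) L),
      IsFractionRing (Algebra.adjoin K (Set.range m)) L :=
    ⟨FractionRing (Algebra.adjoin K (Set.range m)), inferInstance, inferInstance, inferInstance⟩
  have hinj : Function.Injective (algebraMap (Algebra.adjoin K (Set.range m)) Q) :=
    (IsFractionRing.injective (MvPolynomial σ K) Q).comp Subtype.val_injective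
  let _ : Algebra L Q := (IsFractionRing.lift hinj).toAlgebra
  let _ : Algebra K L :=
    ((algebraMap (Algebra.adjoin K (Set.range m)) L).comp (algebraMap K _)).toAlgebra
  let _ : Algebra K Q := ((algebraMap (MvPolynomial σ K) Q).comp (algebraMap K _)).toAlgebra
  have hL : ∀ b, algebraMap L Q (algebraMap (Algebra.adjoin K (Set.range m)) L b) =
      algebraMap (Algebra.adjoin K (Set.range m)) Q b := IsFractionRing.lift_algebraMap hinj
  have : IsScalarTower (Algebra.adjoin K (Set.range m)) L Q :=
    IsScalarTower.of_algebraMap_eq fun b => (hL b).symm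
  have : IsScalarTower K L Q := IsScalarTower.of_algebraMap_eq fun c =>
    (hL (algebraMap K _ c)).symm
  have : IsScalarTower K (MvPolynomial σ K) Q := IsScalarTower.of_algebraMap_eq fun c => rfl
  exact isAlgebraic_X_of_isFractionRing (L := L) (Q := Q)
    (m := m ∘ t)
    (fun i => Algebra.subset_adjoin (Set.mem_range_self (t i))) hJ k

/-- If the Jacobian matrix of a family of polynomials has full rank at some point, then the
general fibres of the family are finite. -/
theorem exists_finite_fibres_of_jacobian {m : X → MvPolynomial σ K} {x : σ → K}
    (hx : ∀ v : σ → K, (∀ t, ∑ k, MvPolynomial.eval x (MvPolynomial.pderiv k (m t)) * v k = 0) →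
      v = 0) :
    ∃ F : MvPolynomial σ K, F ≠ 0 ∧ ∀ θ, MvPolynomial.eval θ F ≠ 0 →
      {θ' | ∀ t, MvPolynomial.eval θ' (m t) = MvPolynomial.eval θ (m t)}.Finite := by
  choose p hp0 hp using isAlgebraic_X_of_jacobian hx
  -- `p k` is an equation for the `k`-th variable over the subalgebra generated by `m`. Where the
  -- leading coefficients do not vanish, it specializes to a nonzero polynomial in one variable.
  refine ⟨∏ k, ((p k).leadingCoeff : MvPolynomial σ K), ?_, fun θ hθ => ?_⟩
  · refine Finset.prod_ne_zero_iff.2 fun k _ h => hp0 k ?_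
    exact Polynomial.leadingCoeff_eq_zero.1 (Subtype.ext h)
  · rw [map_prod, Finset.prod_ne_zero_iff] at hθ
    let ev : ∀ θ : σ → K, Algebra.adjoin K (Set.range m) →+* K := fun θ =>
      (MvPolynomial.eval θ).comp (Algebra.adjoin K (Set.range m)).val.toRingHom
    have hp' : ∀ k, (p k).map (ev θ) ≠ 0 := fun k h =>
      hθ k (Finset.mem_univ k) (by
        have := congrArg (Polynomial.coeff · (p k).natDegree) h
        simpa [ev] using this)
    refine (Set.Finite.pi' fun k => Polynomial.finite_setOfPred_isRoot (hp' k)).subset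
      fun θ' hθ' k => ?_
    -- On the subalgebra, evaluation depends only on the values of `m`. So the whole fibre shares
    -- one specialized equation for each coordinate.
    have hev : ev θ' = ev θ := by
      ext ⟨b, hb⟩
      change MvPolynomial.eval θ' b = MvPolynomial.eval θ b
      induction hb using Algebra.adjoin_induction with
      | mem b hb =>
        obtain ⟨t, rfl⟩ := hb
        exact hθ' t
      | algebraMap c => simp [MvPolynomial.algebraMap_eq]
      | add a b _ _ ha hb => simp [ha, hb]
      | mul a b _ _ ha hb => simp [ha, hb]
    change ((p k).map (ev θ)).eval (θ' k) = 0
    rw [← hev, Polynomial.eval_map]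
    have h1 := congrArg (MvPolynomial.eval θ') (hp k)
    rw [Polynomial.aeval_def, Polynomial.hom_eval₂, MvPolynomial.eval_X, map_zero] at h1
    exact h1

end Jacobian

/-! ### Identifiability from the complex moment forms -/

section Complex

variable {n : ℕ}

lemma map_lin {R R' : Type*} [CommRing R] [CommRing R'] (f : R →+* R') (x : Coord n → R)
    (t : Fin n → R) : f (lin x t) = lin (fun j => f (x j)) (fun a => f (t a)) := by
  simp [lin, dotProduct]

lemma map_quad {R R' : Type*} [CommRing R] [CommRing R'] (f : R →+* R') (x : Coord n → R)
    (t : Fin n → R) : f (quad x t) = quad (fun j => f (x j)) (fun a => f (t a)) := by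
  simp [quad_eq_sum]

lemma map_form {R R' : Type*} [CommRing R] [CommRing R'] (f : R →+* R') (c : R)
    (x : Coord n → R) (t : Fin n → R) :
    f (form c x t) = form (f c) (fun j => f (x j)) (fun a => f (t a)) := by
  simp [form, map_lin, map_quad, map_ofNat]

/-- The derivative of a polynomial at the point `x` in direction `v`. -/
noncomputable def dirDeriv {σ : Type*} [Fintype σ] {K : Type*} [Field K] (x v : σ → K) :
    MvPolynomial σ K →+ K :=
  ∑ k, (AddMonoidHom.mulRight (v k)).comp
    ((MvPolynomial.eval x).toAddMonoidHom.comp (MvPolynomial.pderiv k).toLinearMap.toAddMonoidHom)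

/-! ### Directional derivatives of polynomials -/

section DirDeriv

variable {σ : Type*} [Fintype σ] {K : Type*} [Field K] (x v : σ → K)

lemma dirDeriv_apply (p : MvPolynomial σ K) :
    dirDeriv x v p = ∑ k, MvPolynomial.eval x (MvPolynomial.pderiv k p) * v k := by
  simp [dirDeriv]

lemma dirDeriv_C (a : K) : dirDeriv x v (MvPolynomial.C a) = 0 := by
  simp [dirDeriv_apply]

lemma dirDeriv_X (k : σ) : dirDeriv x v (MvPolynomial.X k) = v k := by
  classical
  rw [dirDeriv_apply, Finset.sum_eq_single k]
  · simp
  · intro j _ hj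
    simp [MvPolynomial.pderiv_X_of_ne hj.symm]
  · simp

lemma dirDeriv_mul (p q : MvPolynomial σ K) :
    dirDeriv x v (p * q) = MvPolynomial.eval x p * dirDeriv x v q +
      MvPolynomial.eval x q * dirDeriv x v p := by
  simp only [dirDeriv_apply, Derivation.leibniz, smul_eq_mul, map_add, map_mul, add_mul,
    Finset.sum_add_distrib, Finset.mul_sum, mul_assoc]

lemma dirDeriv_pow (p : MvPolynomial σ K) (m : ℕ) :
    dirDeriv x v (p ^ (m + 1)) =
      (m + 1) * MvPolynomial.eval x p ^ m * dirDeriv x v p := by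
  induction m with
  | zero => simp
  | succ m ih =>
    rw [pow_succ, dirDeriv_mul, ih, map_pow]
    push_cast
    ring

lemma dirDeriv_C_mul (a : K) (p : MvPolynomial σ K) :
    dirDeriv x v (MvPolynomial.C a * p) = a * dirDeriv x v p := by
  rw [dirDeriv_mul, dirDeriv_C, MvPolynomial.eval_C, mul_zero, add_zero]

/-- This certifies `formDeriv` as the derivative of `form`; `e` picks the coordinates of one mixture
component among all variables. -/
lemma dirDeriv_form (c : K) (e : Coord n → σ) (t : Fin n → K) :
    dirDeriv x v (form (MvPolynomial.C c) (fun j => MvPolynomial.X (e j))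
      (fun a => MvPolynomial.C (t a))) =
      formDeriv c (fun j => x (e j)) (fun j => v (e j)) t := by
  have h1 : dirDeriv x v (lin (fun j => MvPolynomial.X (e j)) (fun a => MvPolynomial.C (t a))) =
      lin (fun j => v (e j)) t := by
    rw [lin, lin, dotProduct, dotProduct, map_sum]
    refine Finset.sum_congr rfl fun a _ => ?_
    rw [dirDeriv_mul, dirDeriv_C, dirDeriv_X, MvPolynomial.eval_C]
    ring
  have h2 : dirDeriv x v (quad (fun j => MvPolynomial.X (e j)) (fun a => MvPolynomial.C (t a))) =
      quad (fun j => v (e j)) t := by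
    rw [quad_eq_sum, quad_eq_sum, map_sum]
    refine Finset.sum_congr rfl fun a _ => ?_
    rw [map_sum]
    refine Finset.sum_congr rfl fun b _ => ?_
    rw [← MvPolynomial.C_mul, dirDeriv_mul, dirDeriv_C, dirDeriv_X, MvPolynomial.eval_C]
    ring
  have h10 : (10 : MvPolynomial σ K) = MvPolynomial.C 10 :=
    (map_ofNat MvPolynomial.C 10).symm
  simp only [form, formDeriv, map_add, h10, dirDeriv_C, dirDeriv_mul,
    dirDeriv_pow, h1, h2, map_lin, map_quad, map_pow, map_mul, MvPolynomial.eval_X,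
    MvPolynomial.eval_C]
  push_cast
  ring

end DirDeriv

/-- The mixture form in symmetric coordinates, as a function. -/
noncomputable def mixForm {r s : ℕ} (w : Fin r ⊕ Fin s → ℂ) (y : (Fin r ⊕ Fin s) × Coord n → ℂ)
    (t : Fin n → ℂ) : ℂ :=
  ∑ i, w i * form (formConst i.isRight) (fun j => y (i, j)) t

theorem exists_finite_mixForm_fibres {r s : ℕ} (hn : 2 ≤ n)
    (hN : (r + s) * Fintype.card (Coord n) +
      Fintype.card (Coord n) * Fintype.card (Coord n) ≤ (n + 4).choose 5)
    {w : Fin r ⊕ Fin s → ℂ} (hw : ∀ i, w i ≠ 0) :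
    ∃ F : MvPolynomial ((Fin r ⊕ Fin s) × Coord n) ℂ, F ≠ 0 ∧
      ∀ y, MvPolynomial.eval y F ≠ 0 → {y' | ∀ t, mixForm w y' t = mixForm w y t}.Finite := by
  obtain ⟨x, hx⟩ := exists_formDeriv_sum_injective hn hN
  let m : (Fin n → ℂ) → MvPolynomial ((Fin r ⊕ Fin s) × Coord n) ℂ := fun t =>
    ∑ i, MvPolynomial.C (w i) * form (MvPolynomial.C (formConst i.isRight))
      (fun j => MvPolynomial.X (i, j)) (fun a => MvPolynomial.C (t a))
  have hm : ∀ y t, MvPolynomial.eval y (m t) = mixForm w y t := by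
    intro y t
    simp [m, mixForm, map_form]
  have hJ : ∀ v : (Fin r ⊕ Fin s) × Coord n → ℂ,
      (∀ t, ∑ k, MvPolynomial.eval (fun k => x k.1 k.2) (MvPolynomial.pderiv k (m t)) * v k = 0) →
      v = 0 := by
    intro v hv
    -- `formDeriv` is linear in the direction, so the nonzero weights are absorbed into it.
    have h := hx (fun i => w i • fun j => v (i, j)) (fun t => by
      rw [← hv t, ← dirDeriv_apply]
      simp only [m, map_sum, dirDeriv_C_mul]
      refine Finset.sum_congr rfl fun i _ => ?_
      rw [dirDeriv_form (e := fun j => (i, j))]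
      simp only [formDeriv, lin_smul, quad_smul]
      ring)
    ext ⟨i, j⟩
    have := congrFun (congrFun h i) j
    simpa [hw i] using this
  obtain ⟨F, hF0, hF⟩ := exists_finite_fibres_of_jacobian hJ
  exact ⟨F, hF0, fun y hy => by simpa only [hm] using hF y hy⟩

/-! ### Matrix entries versus symmetric coordinates -/

variable {ι : Type} {K : Type}

/-- The symmetric coordinates among all entries of the parameters. -/
noncomputable def coordIndex : ι × Coord n → ι × (Fin n ⊕ Fin n × Fin n)
  | (i, .inl a) => (i, .inl a)
  | (i, .inr e) => (i, .inr e.out)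

/-- The symmetric coordinate of an entry of the parameters. -/
def coordClass : ι × (Fin n ⊕ Fin n × Fin n) → ι × Coord n
  | (i, .inl a) => (i, .inl a)
  | (i, .inr p) => (i, .inr s(p.1, p.2))

/-- The symmetric parameters with given coordinates. -/
def ofCoords (y : ι × Coord n → K) : Params ι n K :=
  (fun i a => y (i, .inl a), fun i => symMat fun j => y (i, j))

lemma ofCoords_coords (y : ι × Coord n → K) : (ofCoords y).coords = y ∘ coordClass := by
  ext ⟨i, a | ⟨a, b⟩⟩ <;> rfl

lemma coords_comp_class {θ : Params ι n K} (hθ : ∀ i, (θ.2 i).IsSymm) :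
    (θ.coords ∘ coordIndex) ∘ coordClass = θ.coords := by
  ext ⟨i, a | ⟨a, b⟩⟩
  · rfl
  · exact symEntry_mk (hθ i) a b

lemma coords_injective : Function.Injective (Params.coords (ι := ι) (n := n) (K := K)) := by
  intro θ θ' h
  refine Prod.ext (funext fun i => funext fun a => ?_)
    (funext fun i => Matrix.ext fun a b => ?_)
  · exact congrFun h (i, .inl a)
  · exact congrFun h (i, .inr (a, b))

lemma eval_linForm {θ : Params ι n ℂ} (i : ι) (t : Fin n → ℂ) :
    MvPolynomial.eval t (linForm (θ.1 i)) = lin (fun j => (θ.coords ∘ coordIndex) (i, j)) t := by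
  simp [linForm, lin, dotProduct, coordIndex, Params.coords]

lemma eval_quadForm {θ : Params ι n ℂ} {i : ι} (hθ : (θ.2 i).IsSymm) (t : Fin n → ℂ) :
    MvPolynomial.eval t (quadForm (θ.2 i)) =
      quad (fun j => (θ.coords ∘ coordIndex) (i, j)) t := by
  have : ∀ a b, (θ.coords ∘ coordIndex) (i, .inr s(a, b)) = θ.2 i a b := symEntry_mk hθ
  rw [quad_eq_sum]
  simp only [this, quadForm]
  simp

lemma eval_mixtureForm {r s : ℕ} (w : Fin r ⊕ Fin s → ℂ) {θ : Params (Fin r ⊕ Fin s) n ℂ}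
    (hθ : θ ∈ complexParams (Fin r ⊕ Fin s) n) (t : Fin n → ℂ) :
    MvPolynomial.eval t (mixtureForm w θ) = mixForm w (θ.coords ∘ coordIndex) t := by
  rw [mixtureForm, mixForm, Fintype.sum_sum_type]
  simp [gaussianForm, laplaceForm, eval_linForm, eval_quadForm (hθ _), form, formConst]

/-- Identifiability from the complex moment forms. -/
theorem algebraicallyIdentifiable_mixtureForm {r s : ℕ} (hn : 2 ≤ n)
    (hN : (r + s) * Fintype.card (Coord n) +
      Fintype.card (Coord n) * Fintype.card (Coord n) ≤ (n + 4).choose 5)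
    {w : Fin r ⊕ Fin s → ℂ} (hw : ∀ i, w i ≠ 0) :
    AlgebraicallyIdentifiable (complexParams (Fin r ⊕ Fin s) n)
      (fun θ => mixtureForm w θ) := by
  obtain ⟨F, hF0, hF⟩ := exists_finite_mixForm_fibres hn hN hw
  refine ⟨MvPolynomial.rename coordIndex F, ?_, fun θ hθ hne => ?_⟩
  · obtain ⟨y, hy⟩ : ∃ y, MvPolynomial.eval y F ≠ 0 := by
      by_contra! h
      exact hF0 (MvPolynomial.funext fun y => by rw [h, map_zero])
    have hclass : (y ∘ coordClass) ∘ coordIndex = y := by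
      refine funext fun k => ?_
      rcases k with ⟨i, a | e⟩
      · rfl
      · induction e with | _ a b => ?_
        exact symEntry_mk (symMat_isSymm fun j => y (i, j)) a b
    refine ⟨ofCoords y, fun i => (symMat_isSymm fun j => y (i, j) :), ?_⟩
    rwa [MvPolynomial.eval_rename, ofCoords_coords, hclass]
  · rw [MvPolynomial.eval_rename] at hne
    refine Set.Finite.of_injOn (f := fun θ' : Params (Fin r ⊕ Fin s) n ℂ =>
      θ'.coords ∘ coordIndex) ?_ ?_ (hF _ hne)
    · intro θ' hθ'
      rw [Set.mem_ofPred_eq] at hθ' ⊢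
      intro t
      rw [← eval_mixtureForm w hθ'.1, ← eval_mixtureForm w hθ]
      exact congrArg _ hθ'.2
    · intro θ₁ h₁ θ₂ h₂ h
      refine coords_injective ?_
      rw [← coords_comp_class h₁.1, ← coords_comp_class h₂.1]
      exact congrArg (· ∘ coordClass) h

end Complex

/-! ### Moments of degree 5 -/

section Moments

open scoped NNReal

/-- The polynomial `m ^ 5 + 10 q m ^ 3 + c q ^ 2 m`. -/
def fifthMoment (c m q : ℝ) : ℝ := m ^ 5 + 10 * q * m ^ 3 + c * q ^ 2 * m

/-- The fifth derivative at `0` of the moment generating function `exp g`, where `g t = m t + v t² /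
2`. Each differentiation replaces a factor `p` in front of `exp g` by `p' + p g'`. -/
lemma integral_pow_five_gaussianReal (m : ℝ) (v : ℝ≥0) :
    ∫ x, x ^ 5 ∂gaussianReal m v = fifthMoment 15 m v := by
  have h := iteratedDeriv_mgf_zero (X := id) (μ := gaussianReal m v)
    (by rw [integrableExpSet_id_gaussianReal, interior_univ]; exact Set.mem_univ 0) 5
  rw [mgf_id_gaussianReal] at h
  have hpow : ∫ x, x ^ 5 ∂gaussianReal m v = (gaussianReal m v)[id ^ 5] := rfl
  rw [hpow, ← h]
  set g : ℝ → ℝ := fun t => m * t + v * t ^ 2 / 2 with hg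
  have hd : ∀ (p p' : ℝ → ℝ), (∀ t, HasDerivAt p (p' t) t) →
      deriv (fun t => p t * Real.exp (g t)) =
        fun t => (p' t + p t * (m + v * t)) * Real.exp (g t) := by
    intro p p' hp
    ext t
    have hgt : HasDerivAt g (m + v * t) t := by
      have := ((hasDerivAt_id t).const_mul m).add
        ((((hasDerivAt_id t).pow 2).const_mul (v : ℝ)).div_const 2)
      convert! this using 1
      simp
      ring
    have := (hp t).fun_mul hgt.exp
    rw [HasDerivAt.deriv this]
    ring
  have hl : ∀ t : ℝ, HasDerivAt (fun t => m + v * t) v t := fun t => by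
    simpa using ((hasDerivAt_id t).const_mul (v : ℝ)).const_add m
  have hlp : ∀ (k : ℕ) (t : ℝ), HasDerivAt (fun t => (m + v * t) ^ (k + 1))
      ((k + 1) * (m + v * t) ^ k * v) t := fun k t => by
    simpa using (hl t).fun_pow (k + 1)
  have e0 : (fun t => Real.exp (m * t + v * t ^ 2 / 2)) = fun t => 1 * Real.exp (g t) := by
    simp [hg]
  simp only [iteratedDeriv_succ', iteratedDeriv_zero]
  rw [e0, hd _ (fun _ => 0) fun t => hasDerivAt_const t 1]
  have e1 : (fun t => (0 + 1 * (m + v * t)) * Real.exp (g t)) =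
      fun t => (m + v * t) * Real.exp (g t) := by simp
  rw [e1, hd _ _ hl]
  have e2 : (fun t => (v + (m + v * t) * (m + v * t)) * Real.exp (g t)) =
      fun t => (v + (m + v * t) ^ 2) * Real.exp (g t) := by
    ext t; ring
  rw [e2, hd _ _ fun t => (hlp 1 t).const_add (v : ℝ)]
  have e3 : (fun t => (((1 : ℕ) + 1) * (m + v * t) ^ 1 * v +
        (v + (m + v * t) ^ 2) * (m + v * t)) * Real.exp (g t)) =
      fun t => (3 * v * (m + v * t) + (m + v * t) ^ 3) * Real.exp (g t) := by
    ext t; push_cast; ring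
  rw [e3, hd _ _ fun t => ((hl t).const_mul (3 * (v : ℝ))).fun_add (hlp 2 t)]
  have e4 : (fun t => ((3 * v * v + ((2 : ℕ) + 1) * (m + v * t) ^ 2 * v) +
        (3 * v * (m + v * t) + (m + v * t) ^ 3) * (m + v * t)) * Real.exp (g t)) =
      fun t => ((3 * v ^ 2 + 6 * v * (m + v * t) ^ 2) + (m + v * t) ^ 4) * Real.exp (g t) := by
    ext t; push_cast; ring
  rw [e4, hd _ _ fun t => (((hlp 1 t).const_mul (6 * (v : ℝ))).const_add
    (3 * (v : ℝ) ^ 2)).fun_add (hlp 3 t)]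
  simp [hg, fifthMoment]
  ring

lemma integral_expMeasure (f : ℝ → ℝ) :
    ∫ x, f x ∂(expMeasure 1) = ∫ x in Set.Ioi (0 : ℝ), Real.exp (-x) * f x := by
  rw [expMeasure, gammaMeasure, integral_withDensity_eq_integral_toReal_smul
    (by unfold gammaPDF; fun_prop) (ae_of_all _ fun x => by simp [gammaPDF]),
    ← integral_Ici_eq_integral_Ioi, ← integral_indicator measurableSet_Ici]
  congr 1; ext x
  by_cases hx : 0 ≤ x
  · simp [gammaPDF, gammaPDFReal, hx, Real.exp_nonneg]
  · simp [gammaPDF, gammaPDFReal, hx]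

lemma integral_pow_expMeasure (k : ℕ) : ∫ x, x ^ k ∂(expMeasure 1) = k.factorial := by
  rw [integral_expMeasure, ← Real.Gamma_nat_eq_factorial,
    Real.Gamma_eq_integral (by positivity)]
  refine setIntegral_congr_fun measurableSet_Ioi fun x _ => ?_
  simp

lemma integrable_pow_expMeasure (k : ℕ) : Integrable (fun x => x ^ k) (expMeasure 1) :=
  Integrable.of_integral_ne_zero (by rw [integral_pow_expMeasure]; positivity)

instance : IsProbabilityMeasure (expMeasure 1) := isProbabilityMeasure_expMeasure one_pos

lemma ae_nonneg_expMeasure : ∀ᵐ x ∂(expMeasure 1), 0 ≤ x := by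
  rw [expMeasure, gammaMeasure, ae_withDensity_iff (by unfold gammaPDF; fun_prop)]
  refine ae_of_all _ fun x hx => ?_
  by_contra hneg
  exact hx (gammaPDF_of_neg (not_le.1 hneg))

variable {n : ℕ}

lemma measurable_dot (t : Fin n → ℝ) :
    Measurable fun y : EuclideanSpace ℝ (Fin n) => t ⬝ᵥ y.ofLp := by
  unfold dotProduct
  fun_prop

lemma map_dot_multivariateGaussian (μ : EuclideanSpace ℝ (Fin n))
    {S : Matrix (Fin n) (Fin n) ℝ} (hS : S.PosSemidef) (t : Fin n → ℝ) :
    (multivariateGaussian μ S).map (fun y => t ⬝ᵥ y.ofLp) =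
      gaussianReal (t ⬝ᵥ μ.ofLp) (t ⬝ᵥ S.mulVec t).toNNReal := by
  let L : StrongDual ℝ (EuclideanSpace ℝ (Fin n)) := innerSL ℝ (WithLp.toLp 2 t)
  have hL : ∀ y, L y = t ⬝ᵥ y.ofLp := by
    intro y
    simp [L, PiLp.inner_apply, dotProduct, mul_comm]
  have hmap := IsGaussian.map_eq_gaussianReal (μ := multivariateGaussian μ S) L
  have hvar : Var[L; multivariateGaussian μ S] = t ⬝ᵥ S.mulVec t := by
    have h := covarianceBilin_multivariateGaussian (μ := μ) hS (WithLp.toLp 2 t) (WithLp.toLp 2 t)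
    rw [covarianceBilin_self IsGaussian.memLp_two_id] at h
    exact h
  rw [IsGaussian.integral_dual, integral_id_multivariateGaussian, hL, hvar] at hmap
  rw [← hmap]
  congr 1
  ext y
  rw [hL]

/-- The affine form also covers a Laplace variable conditioned on its exponential factor `W`, with
`b = √W`. -/
lemma integral_affine_pow_five_multivariateGaussian (μ : EuclideanSpace ℝ (Fin n))
    {S : Matrix (Fin n) (Fin n) ℝ} (hS : S.PosSemidef) (t : Fin n → ℝ) (a b : ℝ) :
    ∫ y, (a + b * (t ⬝ᵥ y.ofLp)) ^ 5 ∂(multivariateGaussian μ S) =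
      fifthMoment 15 (a + b * (t ⬝ᵥ μ.ofLp)) (b ^ 2 * (t ⬝ᵥ S.mulVec t)) := by
  have hq : 0 ≤ t ⬝ᵥ S.mulVec t := by simpa using hS.dotProduct_mulVec_nonneg t
  have h1 : ∫ y, (a + b * (t ⬝ᵥ y.ofLp)) ^ 5 ∂(multivariateGaussian μ S) =
      ∫ z, (a + b * z) ^ 5 ∂(gaussianReal (t ⬝ᵥ μ.ofLp) (t ⬝ᵥ S.mulVec t).toNNReal) := by
    rw [← map_dot_multivariateGaussian μ hS t, integral_map (measurable_dot t).aemeasurable (by fun_prop)]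
  have h2 : ∀ m v, ∫ z, (a + b * z) ^ 5 ∂(gaussianReal m v) =
      ∫ z, z ^ 5 ∂(((gaussianReal m v).map (b * ·)).map (a + ·)) := by
    intro m v
    rw [integral_map (by fun_prop) (by fun_prop), integral_map (by fun_prop) (by fun_prop)]
  rw [h1, h2, gaussianReal_map_const_mul, gaussianReal_map_const_add,
    integral_pow_five_gaussianReal, add_comm a]
  congr 1
  simp [hq]

lemma integrable_prod_eval_of_norm_pow {P : Measure (EuclideanSpace ℝ (Fin n))}
    (h : Integrable (fun y => ‖y‖ ^ 5) P) (k : Fin 5 → Fin n) :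
    Integrable (fun y : EuclideanSpace ℝ (Fin n) => ∏ j, y (k j)) P := by
  refine h.mono' (by fun_prop) (ae_of_all _ fun y => ?_)
  rw [norm_prod]
  refine (Finset.prod_le_prod (fun j _ => norm_nonneg _)
    fun j _ => PiLp.norm_apply_le y (k j)).trans ?_
  simp

lemma dot_pow_five (t : Fin n → ℝ) (y : EuclideanSpace ℝ (Fin n)) :
    (t ⬝ᵥ y.ofLp) ^ 5 = ∑ k : Fin 5 → Fin n, (∏ j, t (k j)) * ∏ j, y (k j) := by
  rw [dotProduct, Fintype.sum_pow]
  simp only [Finset.prod_mul_distrib]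

lemma integrable_dot_pow_five {P : Measure (EuclideanSpace ℝ (Fin n))}
    (h : Integrable (fun y => ‖y‖ ^ 5) P) (t : Fin n → ℝ) :
    Integrable (fun y : EuclideanSpace ℝ (Fin n) => (t ⬝ᵥ y.ofLp) ^ 5) P := by
  simp_rw [dot_pow_five]
  exact integrable_finsetSum _ fun k _ => (integrable_prod_eval_of_norm_pow h k).const_mul _

/-- The moments of degree 5 determine the fifth moments of all linear forms. -/
lemma sum_mul_moments {P : Measure (EuclideanSpace ℝ (Fin n))}
    (h : Integrable (fun y => ‖y‖ ^ 5) P) (t : Fin n → ℝ) :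
    ∑ k, (∏ j, t (k j)) * moments 5 P k = ∫ y, (t ⬝ᵥ y.ofLp) ^ 5 ∂P := by
  simp_rw [dot_pow_five]
  rw [integral_finsetSum _ fun k _ => (integrable_prod_eval_of_norm_pow h k).const_mul _]
  simp only [integral_const_mul, moments]

lemma integrable_one_add_norm_pow_multivariateGaussian (μ : EuclideanSpace ℝ (Fin n))
    (S : Matrix (Fin n) (Fin n) ℝ) :
    Integrable (fun y => (1 + ‖y‖) ^ 5) (multivariateGaussian μ S) := by
  have h0 : MemLp (fun y : EuclideanSpace ℝ (Fin n) => ‖y‖) (5 : ℕ) (multivariateGaussian μ S) :=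
    (IsGaussian.memLp_id (multivariateGaussian μ S) (5 : ℕ) (ENNReal.natCast_ne_top 5)).norm
  have hc : MemLp (fun _ : EuclideanSpace ℝ (Fin n) => (1 : ℝ)) (5 : ℕ)
      (multivariateGaussian μ S) := memLp_const 1
  have h1 : MemLp (fun y : EuclideanSpace ℝ (Fin n) => 1 + ‖y‖) (5 : ℕ)
      (multivariateGaussian μ S) := hc.add h0
  refine (h1.integrable_norm_pow (by norm_num)).congr (ae_of_all _ fun y => ?_)
  simp only [Real.norm_eq_abs]
  rw [abs_of_nonneg (by positivity)]

lemma integrable_norm_pow_multivariateGaussian (μ : EuclideanSpace ℝ (Fin n))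
    (S : Matrix (Fin n) (Fin n) ℝ) :
    Integrable (fun y => ‖y‖ ^ 5) (multivariateGaussian μ S) := by
  refine (integrable_one_add_norm_pow_multivariateGaussian μ S).mono' (by fun_prop)
    (ae_of_all _ fun y => ?_)
  rw [Real.norm_of_nonneg (by positivity)]
  gcongr
  linarith

lemma measurable_laplaceMap (μ : EuclideanSpace ℝ (Fin n)) :
    Measurable fun p : ℝ × EuclideanSpace ℝ (Fin n) => μ + √p.1 • p.2 := by
  fun_prop

lemma integrable_norm_pow_multivariateLaplace (μ : EuclideanSpace ℝ (Fin n))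
    (S : Matrix (Fin n) (Fin n) ℝ) :
    Integrable (fun y => ‖y‖ ^ 5) (multivariateLaplace μ S) := by
  rw [multivariateLaplace, integrable_map_measure (by fun_prop)
    (measurable_laplaceMap μ).aemeasurable]
  -- Since `√x ≤ x² + 1`, the norm is dominated by a product of functions of `x` and `y`, with a
  -- polynomial in `x`.
  have hexp : Integrable (fun x : ℝ => (x ^ 2 + 1) ^ 5) (expMeasure 1) := by
    simp_rw [add_pow, ← pow_mul]
    exact integrable_finsetSum _ fun k _ =>
      ((integrable_pow_expMeasure _).mul_const _).mul_const _
  refine ((hexp.mul_prod (integrable_one_add_norm_pow_multivariateGaussian 0 S)).const_mul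
    ((1 + ‖μ‖) ^ 5)).mono' (by fun_prop) (ae_of_all _ fun p => ?_)
  simp only [Function.comp]
  rw [Real.norm_of_nonneg (by positivity), ← mul_pow, ← mul_pow]
  gcongr
  have hs : √p.1 ≤ p.1 ^ 2 + 1 := by
    rw [Real.sqrt_le_left (by positivity)]
    nlinarith [sq_nonneg (p.1 - 1), sq_nonneg (p.1 ^ 2), sq_nonneg p.1]
  have h1 : ‖μ + √p.1 • p.2‖ ≤ ‖μ‖ + √p.1 * ‖p.2‖ := by
    refine (norm_add_le _ _).trans ?_
    rw [norm_smul, Real.norm_of_nonneg (Real.sqrt_nonneg _)]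
  have h2 : √p.1 * ‖p.2‖ ≤ (p.1 ^ 2 + 1) * ‖p.2‖ := by gcongr
  have h3 : 0 ≤ ‖μ‖ * p.1 ^ 2 := by positivity
  have h4 : 0 ≤ ‖μ‖ * ((p.1 ^ 2 + 1) * ‖p.2‖) := by positivity
  have h5 : 0 ≤ p.1 ^ 2 := by positivity
  linarith

lemma integral_dot_pow_five_multivariateGaussian (μ : EuclideanSpace ℝ (Fin n))
    {S : Matrix (Fin n) (Fin n) ℝ} (hS : S.PosSemidef) (t : Fin n → ℝ) :
    ∫ y, (t ⬝ᵥ y.ofLp) ^ 5 ∂(multivariateGaussian μ S) =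
      fifthMoment 15 (t ⬝ᵥ μ.ofLp) (t ⬝ᵥ S.mulVec t) := by
  simpa using integral_affine_pow_five_multivariateGaussian μ hS t 0 1

/-- The exponential law has first moment `1` and second moment `2`: the coefficient `10` is kept and
`15` becomes `30`. The identity `√x ^ 2 = x` holds only almost everywhere. -/
lemma integral_fifthMoment_expMeasure (a q : ℝ) :
    ∫ x, fifthMoment 15 a (√x ^ 2 * q) ∂(expMeasure 1) = fifthMoment 30 a q := by
  have h : ∀ᵐ x ∂(expMeasure 1), fifthMoment 15 a (√x ^ 2 * q) =
      a ^ 5 * x ^ 0 + (10 * q * a ^ 3 * x ^ 1 + 15 * q ^ 2 * a * x ^ 2) := by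
    filter_upwards [ae_nonneg_expMeasure] with x hx
    rw [Real.sq_sqrt hx, fifthMoment]
    ring
  have hi := fun (c : ℝ) (k : ℕ) => (integrable_pow_expMeasure k).const_mul c
  rw [integral_congr_ae h, integral_add (hi _ _) ((hi _ _).fun_add (hi _ _)),
    integral_add (hi _ _) (hi _ _)]
  simp only [integral_const_mul, integral_pow_expMeasure, fifthMoment]
  norm_num [Nat.factorial]
  ring

lemma integral_dot_pow_five_multivariateLaplace (μ : EuclideanSpace ℝ (Fin n))
    {S : Matrix (Fin n) (Fin n) ℝ} (hS : S.PosSemidef) (t : Fin n → ℝ) :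
    ∫ y, (t ⬝ᵥ y.ofLp) ^ 5 ∂(multivariateLaplace μ S) =
      fifthMoment 30 (t ⬝ᵥ μ.ofLp) (t ⬝ᵥ S.mulVec t) := by
  have hint := integrable_dot_pow_five (integrable_norm_pow_multivariateLaplace μ S) t
  have hmeas : AEStronglyMeasurable (fun y : EuclideanSpace ℝ (Fin n) => (t ⬝ᵥ y.ofLp) ^ 5)
      (multivariateLaplace μ S) := ((measurable_dot t).pow_const 5).aestronglyMeasurable
  rw [multivariateLaplace] at hint hmeas ⊢
  rw [integrable_map_measure hmeas (measurable_laplaceMap μ).aemeasurable] at hint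
  rw [integral_map (measurable_laplaceMap μ).aemeasurable hmeas]
  refine (integral_prod _ hint).trans ?_
  rw [← integral_fifthMoment_expMeasure]
  refine integral_congr_ae (ae_of_all _ fun x => ?_)
  have h := integral_affine_pow_five_multivariateGaussian 0 hS t (t ⬝ᵥ μ.ofLp) √x
  rw [WithLp.ofLp_zero, dotProduct_zero, mul_zero, add_zero] at h
  refine Eq.trans (integral_congr_ae (ae_of_all _ fun y => ?_)) h
  simp only [Function.comp, WithLp.ofLp_add, WithLp.ofLp_smul, dotProduct_add, dotProduct_smul,
    smul_eq_mul]

end Moments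

/-! ### Identifiability of the probability distributions -/

section Real

variable {n r s : ℕ} {ι : Type}

/-- Real parameters as complex parameters. -/
def Params.toComplex (θ : Params ι n ℝ) : Params ι n ℂ :=
  (fun i a => (θ.1 i a : ℂ), fun i => (θ.2 i).map fun x : ℝ => (x : ℂ))

lemma coords_toComplex (θ : Params ι n ℝ) :
    θ.toComplex.coords = fun k => (θ.coords k : ℂ) := by
  ext ⟨i, a | ⟨a, b⟩⟩ <;> rfl

lemma toComplex_injective : Function.Injective (Params.toComplex (ι := ι) (n := n)) := by
  intro θ θ' h
  refine coords_injective (funext fun k => ?_)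
  have := congrFun (congrArg Params.coords h) k
  rw [coords_toComplex, coords_toComplex] at this
  exact Complex.ofReal_injective this

lemma toComplex_mem {θ : Params ι n ℝ} (hθ : θ ∈ realParams ι n) :
    θ.toComplex ∈ complexParams ι n := by
  intro i
  have h := (hθ i).isHermitian
  rw [Matrix.IsHermitian, Matrix.conjTranspose_eq_transpose_of_trivial] at h
  exact Matrix.IsSymm.map h _

lemma eval_linForm_ofReal (μ t : Fin n → ℝ) :
    MvPolynomial.eval (fun a => (t a : ℂ)) (linForm fun a => (μ a : ℂ)) = (t ⬝ᵥ μ : ℝ) := by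
  simp [linForm, dotProduct, mul_comm]

lemma eval_quadForm_ofReal (S : Matrix (Fin n) (Fin n) ℝ) (t : Fin n → ℝ) :
    MvPolynomial.eval (fun a => (t a : ℂ)) (quadForm (S.map fun x : ℝ => (x : ℂ))) =
      (t ⬝ᵥ S.mulVec t : ℝ) := by
  simp only [quadForm, dotProduct, Matrix.mulVec, Finset.mul_sum, map_sum, map_mul,
    MvPolynomial.eval_C, MvPolynomial.eval_X, Matrix.map_apply]
  push_cast
  exact Finset.sum_congr rfl fun a _ => Finset.sum_congr rfl fun b _ => by ring

/-- The fifth moment of a linear form under the mixture. -/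
noncomputable def mixFifthMoment (w : Fin r ⊕ Fin s → ℝ) (θ : Params (Fin r ⊕ Fin s) n ℝ)
    (t : Fin n → ℝ) : ℝ :=
  (∑ i : Fin r, w (.inl i) * fifthMoment 15 (t ⬝ᵥ θ.1 (.inl i)) (t ⬝ᵥ (θ.2 (.inl i)).mulVec t)) +
    ∑ j : Fin s, w (.inr j) *
      fifthMoment 30 (t ⬝ᵥ θ.1 (.inr j)) (t ⬝ᵥ (θ.2 (.inr j)).mulVec t)

lemma eval_mixtureForm_toComplex (w : Fin r ⊕ Fin s → ℝ) (θ : Params (Fin r ⊕ Fin s) n ℝ)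
    (t : Fin n → ℝ) :
    MvPolynomial.eval (fun a => (t a : ℂ)) (mixtureForm (fun i => (w i : ℂ)) θ.toComplex) =
      mixFifthMoment w θ t := by
  simp only [mixtureForm, gaussianForm, laplaceForm, mixFifthMoment, fifthMoment,
    Params.toComplex, map_add, map_sum, map_mul, map_pow, map_ofNat, MvPolynomial.eval_C,
    eval_linForm_ofReal, eval_quadForm_ofReal]
  push_cast
  rfl

lemma integrable_norm_pow_mixture (w : Fin r ⊕ Fin s → ℝ) (θ : Params (Fin r ⊕ Fin s) n ℝ) :
    Integrable (fun y => ‖y‖ ^ 5) (mixture w θ) := by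
  refine Integrable.add_measure ?_ ?_
  · exact integrable_finsetSum_measure.2 fun i _ =>
      (integrable_norm_pow_multivariateGaussian _ _).smul_measure ENNReal.ofReal_ne_top
  · exact integrable_finsetSum_measure.2 fun i _ =>
      (integrable_norm_pow_multivariateLaplace _ _).smul_measure ENNReal.ofReal_ne_top

lemma integral_dot_pow_five_mixture {w : Fin r ⊕ Fin s → ℝ} (hw : ∀ i, 0 < w i)
    {θ : Params (Fin r ⊕ Fin s) n ℝ} (hθ : θ ∈ realParams (Fin r ⊕ Fin s) n) (t : Fin n → ℝ) :
    ∫ y, (t ⬝ᵥ y.ofLp) ^ 5 ∂(mixture w θ) = mixFifthMoment w θ t := by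
  have hG := fun i : Fin r => integrable_dot_pow_five
    ((integrable_norm_pow_multivariateGaussian (WithLp.toLp 2 (θ.1 (.inl i)))
      (θ.2 (.inl i))).smul_measure (ENNReal.ofReal_ne_top (r := w (.inl i)))) t
  have hL := fun j : Fin s => integrable_dot_pow_five
    ((integrable_norm_pow_multivariateLaplace (WithLp.toLp 2 (θ.1 (.inr j)))
      (θ.2 (.inr j))).smul_measure (ENNReal.ofReal_ne_top (r := w (.inr j)))) t
  rw [mixture, integral_add_measure (integrable_finsetSum_measure.2 fun i _ => hG i)
    (integrable_finsetSum_measure.2 fun j _ => hL j),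
    integral_finsetSum_measure fun i _ => hG i, integral_finsetSum_measure fun j _ => hL j]
  simp only [integral_smul_measure, integral_dot_pow_five_multivariateGaussian _ (hθ _),
    integral_dot_pow_five_multivariateLaplace _ (hθ _), ENNReal.toReal_ofReal (hw _).le,
    smul_eq_mul, mixFifthMoment]

/-- The degree-5 moments determine the fifth moment of every real linear form, which is the value of
the moment form at a real point. Real points are Zariski dense in complex space. -/
lemma mixtureForm_eq_of_moments_eq {w : Fin r ⊕ Fin s → ℝ} (hw : ∀ i, 0 < w i)
    {θ θ' : Params (Fin r ⊕ Fin s) n ℝ} (hθ : θ ∈ realParams (Fin r ⊕ Fin s) n)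
    (hθ' : θ' ∈ realParams (Fin r ⊕ Fin s) n)
    (h : moments 5 (mixture w θ') = moments 5 (mixture w θ)) :
    mixtureForm (fun i => (w i : ℂ)) θ'.toComplex =
      mixtureForm (fun i => (w i : ℂ)) θ.toComplex := by
  refine MvPolynomial.funext_set (fun _ => Set.range ((↑) : ℝ → ℂ))
    (fun _ => Set.infinite_range_of_injective Complex.ofReal_injective) fun z hz => ?_
  choose t ht using fun a => hz a (Set.mem_univ a)
  obtain rfl : (fun a => (t a : ℂ)) = z := funext ht
  rw [eval_mixtureForm_toComplex, eval_mixtureForm_toComplex,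
    ← integral_dot_pow_five_mixture hw hθ', ← integral_dot_pow_five_mixture hw hθ,
    ← sum_mul_moments (integrable_norm_pow_mixture w θ'),
    ← sum_mul_moments (integrable_norm_pow_mixture w θ), h]

/-- One of the two parts will serve as the real polynomial certifying genericity. -/
lemma exists_real_imaginary_part {σ : Type*} (F : MvPolynomial σ ℂ) :
    ∃ G H : MvPolynomial σ ℝ, ∀ y : σ → ℝ, MvPolynomial.eval (fun k => (y k : ℂ)) F =
      (MvPolynomial.eval y G : ℝ) + Complex.I * (MvPolynomial.eval y H : ℝ) := by
  induction F using MvPolynomial.induction_on with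
  | C c =>
    refine ⟨MvPolynomial.C c.re, MvPolynomial.C c.im, fun y => ?_⟩
    simp [mul_comm Complex.I, Complex.re_add_im]
  | add p q hp hq =>
    obtain ⟨G, H, h⟩ := hp
    obtain ⟨G', H', h'⟩ := hq
    refine ⟨G + G', H + H', fun y => ?_⟩
    rw [map_add, h, h']
    push_cast [map_add]
    ring
  | mul_X p k hp =>
    obtain ⟨G, H, h⟩ := hp
    refine ⟨G * MvPolynomial.X k, H * MvPolynomial.X k, fun y => ?_⟩
    rw [map_mul, h, MvPolynomial.eval_X, map_mul, map_mul, MvPolynomial.eval_X]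
    push_cast
    ring

/-- Diagonally dominant symmetric matrices are positive semidefinite. -/
lemma posSemidef_symMat {x : Coord n → ℝ} (hdiag : ∀ a, (n : ℝ) ≤ x (.inr s(a, a)))
    (hoff : ∀ a b, a ≠ b → x (.inr s(a, b)) ∈ Set.Icc (0 : ℝ) 1) : (symMat x).PosSemidef := by
  refine Matrix.PosSemidef.of_dotProduct_mulVec_nonneg ?_ fun t => ?_
  · rw [Matrix.IsHermitian, Matrix.conjTranspose_eq_transpose_of_trivial]
    exact symMat_isSymm x
  · have hquad : star t ⬝ᵥ (symMat x).mulVec t = ∑ a, ∑ b, x (.inr s(a, b)) * (t a * t b) := by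
      rw [← quad_eq_sum, quad, star_trivial]
    rw [hquad]
    -- An off-diagonal entry in `[0, 1]` costs at most `(t a ^ 2 + t b ^ 2) / 2`. Summed over all
    -- pairs this is `n ∑ t a ^ 2`, exactly what the diagonal supplies, so the left side is `0`.
    have hle : ∑ a, ∑ b, (-(t a ^ 2 + t b ^ 2) / 2 + if a = b then n * t a ^ 2 else 0) ≤
        ∑ a, ∑ b, x (.inr s(a, b)) * (t a * t b) := by
      refine Finset.sum_le_sum fun a _ => Finset.sum_le_sum fun b _ => ?_
      by_cases hab : a = b
      · subst hab
        rw [if_pos rfl]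
        nlinarith [mul_le_mul_of_nonneg_right (hdiag a) (sq_nonneg (t a)), sq_nonneg (t a)]
      · rw [if_neg hab]
        obtain ⟨h0, h1⟩ := hoff a b hab
        nlinarith [mul_nonneg h0 (sq_nonneg (t a + t b)),
          mul_nonneg (sub_nonneg.2 h1) (add_nonneg (sq_nonneg (t a)) (sq_nonneg (t b)))]
    refine le_trans (le_of_eq ?_) hle
    simp only [Finset.sum_add_distrib, Finset.sum_ite_eq, Finset.mem_univ, if_true,
      ← Finset.sum_div, Finset.sum_neg_distrib, Finset.sum_const, Finset.card_univ,
      Fintype.card_fin, nsmul_eq_mul, ← Finset.mul_sum]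
    ring

/-- The real positive semidefinite parameters are Zariski dense in the complex parameters. -/
lemma exists_realParams_eval_ne_zero
    {F : MvPolynomial (ι × (Fin n ⊕ Fin n × Fin n)) ℂ} {θ : Params ι n ℂ}
    (hθ : θ ∈ complexParams ι n) (hF : MvPolynomial.eval θ.coords F ≠ 0) :
    ∃ θ' ∈ realParams ι n, MvPolynomial.eval θ'.toComplex.coords F ≠ 0 := by
  classical
  by_contra! hzero
  apply hF
  -- A product of infinite sets consisting of diagonally dominant parameters; a polynomial vanishing
  -- on such a product is zero.
  let B : ι × Coord n → Set ℝ := fun k => match k.2 with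
    | .inl _ => Set.univ
    | .inr e => if e.IsDiag then Set.Ici (n : ℝ) else Set.Icc 0 1
  have hB : ∀ k, (B k).Infinite := by
    rintro ⟨i, a | e⟩
    · exact Set.infinite_univ
    · simp only [B]
      split_ifs
      · exact Set.Ici_infinite _
      · exact Set.Icc_infinite one_pos
  have h : MvPolynomial.rename coordClass F = 0 := by
    refine MvPolynomial.funext_set (fun k => ((↑) : ℝ → ℂ) '' B k)
      (fun k => (hB k).image Complex.ofReal_injective.injOn) fun z hz => ?_
    choose y hyB hy using fun k => hz k (Set.mem_univ k)
    obtain rfl : (fun k => (y k : ℂ)) = z := funext hy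
    have hmem : (ofCoords y : Params ι n ℝ) ∈ realParams ι n := fun i => by
      refine posSemidef_symMat (x := fun j => y (i, j)) (fun a => ?_) fun a b hab => ?_
      · simpa [B] using hyB (i, .inr s(a, a))
      · simpa [B, hab] using hyB (i, .inr s(a, b))
    rw [map_zero, MvPolynomial.eval_rename, ← hzero _ hmem, coords_toComplex, ofCoords_coords]
    rfl
  rw [← coords_comp_class hθ, ← MvPolynomial.eval_rename, h, map_zero]

/-- Identifiability of the mixtures follows from identifiability of their moment forms. -/
theorem algebraicallyIdentifiable_mixture {w : Fin r ⊕ Fin s → ℝ} (hw : ∀ i, 0 < w i)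
    (h : AlgebraicallyIdentifiable (complexParams (Fin r ⊕ Fin s) n)
      fun θ => mixtureForm (fun i => (w i : ℂ)) θ) :
    AlgebraicallyIdentifiable (realParams (Fin r ⊕ Fin s) n)
      fun θ => moments 5 (mixture w θ) := by
  obtain ⟨F, ⟨θ, hθ, hFθ⟩, hF⟩ := h
  obtain ⟨θ₀, hθ₀, hFθ₀⟩ := exists_realParams_eval_ne_zero hθ hFθ
  obtain ⟨G, H, hGH⟩ := exists_real_imaginary_part F
  have hfin : ∀ θ ∈ realParams (Fin r ⊕ Fin s) n,
      MvPolynomial.eval θ.toComplex.coords F ≠ 0 →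
      {θ' | θ' ∈ realParams (Fin r ⊕ Fin s) n ∧
        moments 5 (mixture w θ') = moments 5 (mixture w θ)}.Finite := by
    intro θ hθ hne
    refine Set.Finite.of_injOn (f := Params.toComplex) ?_ toComplex_injective.injOn
      (hF θ.toComplex (toComplex_mem hθ) hne)
    intro θ' hθ'
    rw [Set.mem_ofPred_eq] at hθ' ⊢
    exact ⟨toComplex_mem hθ'.1, mixtureForm_eq_of_moments_eq hw hθ hθ'.1 hθ'.2⟩
  have hre : ∀ θ : Params (Fin r ⊕ Fin s) n ℝ, MvPolynomial.eval θ.toComplex.coords F =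
      (MvPolynomial.eval θ.coords G : ℝ) + Complex.I * (MvPolynomial.eval θ.coords H : ℝ) := by
    intro θ
    rw [coords_toComplex, hGH]
  have hne : ∀ θ : Params (Fin r ⊕ Fin s) n ℝ, MvPolynomial.eval θ.toComplex.coords F ≠ 0 ↔
      MvPolynomial.eval θ.coords G ≠ 0 ∨ MvPolynomial.eval θ.coords H ≠ 0 := by
    intro θ
    rw [hre, Ne, Complex.ext_iff, ← not_and_or]
    simp
  -- Whichever part is nonzero at `θ₀` is taken; where it is nonzero, so is `F`.
  rcases (hne θ₀).1 hFθ₀ with h | h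
  · exact ⟨G, ⟨θ₀, hθ₀, h⟩, fun θ hθ hG => hfin θ hθ ((hne θ).2 (.inl hG))⟩
  · exact ⟨H, ⟨θ₀, hθ₀, h⟩, fun θ hθ hH => hfin θ hθ ((hne θ).2 (.inr hH))⟩

end Real

/-! ### The numerical condition -/

lemma card_coord (n : ℕ) : Fintype.card (Coord n) = (n + 1).choose 2 + n := by
  rw [Fintype.card_sum, Fintype.card_fin, Sym2.card, Fintype.card_fin, add_comm]

lemma card_mul_add_le_choose {n r s : ℕ} (hn : 1 ≤ n)
    (hrs : (r : ℝ) + (s : ℝ) ≤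
      ((n + 4).choose 5 : ℝ) / (((n + 1).choose 2 : ℝ) + (n : ℝ))
        - (((n + 1).choose 2 : ℝ) + (n : ℝ))) :
    (r + s) * Fintype.card (Coord n) + Fintype.card (Coord n) * Fintype.card (Coord n) ≤
      (n + 4).choose 5 := by
  have hD : (0 : ℝ) < (n + 1).choose 2 + n := by positivity
  rw [le_sub_iff_add_le, le_div_iff₀ hD] at hrs
  rw [card_coord, ← add_mul]
  exact_mod_cast hrs

end GaussLaplace

theorem mainTheorem8 (n r s : ℕ) (hn : 1 ≤ n)
    (hrs : (r : ℝ) + (s : ℝ) ≤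
      ((n + 4).choose 5 : ℝ) / (((n + 1).choose 2 : ℝ) + (n : ℝ))
        - (((n + 1).choose 2 : ℝ) + (n : ℝ))) :
    (∀ w : Fin r ⊕ Fin s → ℂ, (∀ i, w i ≠ 0) →
      GaussLaplace.AlgebraicallyIdentifiable
        (GaussLaplace.complexParams (Fin r ⊕ Fin s) n)
        (fun θ => GaussLaplace.mixtureForm w θ)) ∧
    (∀ w : Fin r ⊕ Fin s → ℝ, (∀ i, 0 < w i) → ∑ i, w i = 1 →
      GaussLaplace.AlgebraicallyIdentifiable
        (GaussLaplace.realParams (Fin r ⊕ Fin s) n)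
        (fun θ => GaussLaplace.moments 5 (GaussLaplace.mixture w θ))) := by
  have hN := GaussLaplace.card_mul_add_le_choose hn hrs
  -- For `n = 1` the numerical condition would read `2 (r + s) + 4 ≤ 1`.
  have hn2 : 2 ≤ n := by
    by_contra h
    obtain rfl : n = 1 := by omega
    rw [GaussLaplace.card_coord] at hN
    norm_num [Nat.choose] at hN
    omega
  have hcomplex : ∀ w : Fin r ⊕ Fin s → ℂ, (∀ i, w i ≠ 0) →
      GaussLaplace.AlgebraicallyIdentifiable
        (GaussLaplace.complexParams (Fin r ⊕ Fin s) n)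
        (fun θ => GaussLaplace.mixtureForm w θ) :=
    fun w hw => GaussLaplace.algebraicallyIdentifiable_mixtureForm hn2 hN hw
  exact ⟨hcomplex, fun w hw _ => GaussLaplace.algebraicallyIdentifiable_mixture hw
    (hcomplex _ fun i => Complex.ofReal_ne_zero.2 (hw i).ne')⟩
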